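/- Let $d\in\mathbb N$, $T\in(0,\infty]$, $\mathcal O_T=(0,T)\times\mathbb R^d$. For $X=(t,x)$, $Y=(s,y)$ in $\mathbb R\times\mathbb R^d$ put $\delta(X,Y)=\max\{|x-y|,|t-s|^{1/2}\}$ and $Q_c(X)=\{Y:\delta(X,Y)<c\}$. Let $|\cdot|$ also denote Lebesgue measure on $\mathbb R^{d+1}$. A set $D\subset\mathbb R^{d+1}$ is called $A$-type, with constant $A>0$, if $|D\cap Q_\rho(X)|\ge A\,|Q_\rho(X)|$ for all $X\in D$ and all $0<\rho\le\operatorname{diam}D$ (diameter with respect to $\delta$). For a jointly measurable random field $h$, $p\ge1$, $\theta\ge0$, the stochastic Campanato seminorm is $$[h]_{\mathscr L^{p,\theta}((D;\delta);L^p(\Omega))}=\Big(\sup_{X\in D,\;c>0}\frac1{|Q|^{1+\theta}}\,\mathbb E\int_Q\int_Q|h(Y)-h(Z)|^p\,dZ\,dY\Big)^{1/p},\qquad Q=D\cap Q_c(X).$$ Let $W$ be a standard one-dimensional Brownian motion on a probability space, defined for all finite times $t\in[0,T]$. For deterministic $K,g:\mathbb R\times\mathbb R^d\to\mathbb R$,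 the stochastic convolution is $$\mathcal Kg(t,x)=\int_0^t\int_{\mathbb R^d}K(t-r,y)\,g(r,x-y)\,dy\,dW(r),\qquad (t,x)\in\mathcal O_T,$$ the stochastic integral being the $L^2(\Omega)$-limit of integrals of deterministic step functions. **Theorem 2.1.** Let $p\ge1$, $0<\beta<1$, $\gamma_1,\gamma_2>0$, and let $N_0,N_1,N_2,C_g\geq 0$, $A>0$, $R>0$ be constants. Put $\gamma=\min\{\gamma_1,\gamma_2,\beta\}$ and $\theta=1+\frac{\gamma p}{d+2}$. There is a finite constant $N$, depending only on $d,T,p,\beta,\gamma_1,\gamma_2,N_0,N_1,N_2,C_g,A,R$, such that the following holds. Let $K$ be a measurable deterministic kernel such that for all finite $t\in(0,T]$ and all $0\le s<t$ $$\int_0^s\Big(\int_{\mathbb R^d}|K(t-r,z)-K(s-r,z)|(1+|z|^\beta)\,dz\Big)^2dr\le N_1(t-s)^{\gamma_1},\tag{2.2}$$ $$\int_0^s\Big(\int_{\mathbb R^d}|K(s-r,z)|\,dz\Big)^2dr\le N_0,\tag{2.3}$$ $$\int_s^t\Big(\int_{\mathbb R^d}|K(t-r,z)|(1+|z|^\beta)\,dz\Big)^2dr\le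 N_2(t-s)^{\gamma_2}.\tag{2.4}$$ Let $g$ be deterministic with $g(0,0)=0$ and $|g(X)-g(Y)|\le C_g\,\delta(X,Y)^\beta$ for all $X,Y\in[0,\infty)\times\mathbb R^d$. Then $\mathcal Kg$ is well defined on $\mathcal O_T$ (for every $(t,x)\in\mathcal O_T$ the inner integral converges absolutely for almost every $r\in(0,t)$ and is square integrable in $r$ over $(0,t)$) and has a jointly measurable version; and for every such version and every $A$-type domain (with constant $A$) $D\subset\mathbb R^{d+1}$ with $D\subset\{(t,x):|t|\le R,\ |x|\le R\}$ and $\overline D\subset\mathcal O_T$, $$[\mathcal Kg]_{\mathscr L^{p,\theta}((D;\delta);L^p(\Omega))}\le N.$$ -/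

import Mathlib

open MeasureTheory ProbabilityTheory Filter Topology Set
open scoped NNReal ENNReal

namespace StochConv

noncomputable section

/-- Space-time `ℝ × ℝ^d`; a point is `X = (t, x)`, and `volume` is Lebesgue measure on `ℝ^{d+1}`. -/
abbrev SpaceTime (d : ℕ) : Type := ℝ × EuclideanSpace ℝ (Fin d)

/-- The parabolic distance `δ(X, Y) = max {|x - y|, |t - s|^{1/2}}`. -/
def pdist {d : ℕ} (X Y : SpaceTime d) : ℝ :=
  max ‖X.2 - Y.2‖ (Real.sqrt |X.1 - Y.1|)

/-- The parabolic ball `Q_c(X) = {Y : δ(X, Y) < c}`. -/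
def pball {d : ℕ} (X : SpaceTime d) (c : ℝ) : Set (SpaceTime d) :=
  {Y | pdist X Y < c}

/-- The diameter of `D` with respect to the parabolic distance. -/
def pdiam {d : ℕ} (D : Set (SpaceTime d)) : ℝ≥0∞ :=
  ⨆ X ∈ D, ⨆ Y ∈ D, ENNReal.ofReal (pdist X Y)

/-- `𝒪_T = (0, T) × ℝ^d`, where `T ∈ (0, ∞]`. -/
def timeStrip (d : ℕ) (T : ℝ≥0∞) : Set (SpaceTime d) :=
  {X | 0 < X.1 ∧ ENNReal.ofReal X.1 < T}

/-- `D` is `A`-type with constant `A`: `|D ∩ Q_ρ(X)| ≥ A |Q_ρ(X)|` for all `X ∈ D` and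
`0 < ρ ≤ diam D`. -/
def IsATypeWith {d : ℕ} (A : ℝ≥0) (D : Set (SpaceTime d)) : Prop :=
  0 < A ∧ ∀ X ∈ D, ∀ ρ : ℝ, 0 < ρ → ENNReal.ofReal ρ ≤ pdiam D →
    A * volume (pball X ρ) ≤ volume (D ∩ pball X ρ)

/-- `g` is Hölder continuous of exponent `β` on `[0, ∞) × ℝ^d` with respect to the parabolic
distance, with Hölder constant `C`. -/
def IsPHolderWith {d : ℕ} (C : ℝ≥0) (β : ℝ) (g : SpaceTime d → ℝ) : Prop :=
  ∀ X Y : SpaceTime d, 0 ≤ X.1 → 0 ≤ Y.1 → |g X - g Y| ≤ C * pdist X Y ^ β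

/-- The three bounds on the kernel, for all `0 ≤ s < t ≤ T` (with `t < ∞`). -/
structure KernelBounds {d : ℕ} (T : ℝ≥0∞) (β γ₁ γ₂ : ℝ) (N₀ N₁ N₂ : ℝ≥0)
    (K : SpaceTime d → ℝ) : Prop where
  increment : ∀ s t : ℝ, 0 ≤ s → s < t → ENNReal.ofReal t ≤ T →
    ∫⁻ r in Ioo 0 s, (∫⁻ z : EuclideanSpace ℝ (Fin d),
        ‖K (t - r, z) - K (s - r, z)‖ₑ * ENNReal.ofReal (1 + ‖z‖ ^ β)) ^ 2
      ≤ N₁ * ENNReal.ofReal ((t - s) ^ γ₁)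
  bound : ∀ s t : ℝ, 0 ≤ s → s < t → ENNReal.ofReal t ≤ T →
    ∫⁻ r in Ioo 0 s, (∫⁻ z : EuclideanSpace ℝ (Fin d), ‖K (s - r, z)‖ₑ) ^ 2 ≤ N₀
  tail : ∀ s t : ℝ, 0 ≤ s → s < t → ENNReal.ofReal t ≤ T →
    ∫⁻ r in Ioo s t, (∫⁻ z : EuclideanSpace ℝ (Fin d),
        ‖K (t - r, z)‖ₑ * ENNReal.ofReal (1 + ‖z‖ ^ β)) ^ 2
      ≤ N₂ * ENNReal.ofReal ((t - s) ^ γ₂)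

section Wiener

variable {Ω : Type*} [MeasurableSpace Ω]

/-- `W` is a standard one-dimensional Brownian motion (Wiener process) on the time interval
`{t : 0 ≤ t ≤ T, t < ∞}`, where `T ∈ (0, ∞]`. -/
structure IsWienerProcess (T : ℝ≥0∞) (W : ℝ≥0 → Ω → ℝ) (P : Measure Ω) : Prop where
  zero : ∀ᵐ ω ∂P, W 0 ω = 0
  indep : HasIndepIncrements (fun t : {t : ℝ≥0 // (t : ℝ≥0∞) ≤ T} ↦ W t) P
  gaussian : ∀ s t : ℝ≥0, s ≤ t → (t : ℝ≥0∞) ≤ T →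
    HasLaw (fun ω ↦ W t ω - W s ω) (gaussianReal 0 (t - s)) P
  cont : ∀ᵐ ω ∂P, ContinuousOn (fun t : ℝ≥0 ↦ W t ω) {t : ℝ≥0 | (t : ℝ≥0∞) ≤ T}

/-- A deterministic step function `∑ i, c_i 1_{(a_i, b_i]}` with `0 ≤ a_i ≤ b_i ≤ t`. -/
structure StepFunction (t : ℝ) where
  n : ℕ
  left : Fin n → ℝ≥0
  right : Fin n → ℝ≥0
  coeff : Fin n → ℝ
  left_le_right : ∀ i, left i ≤ right i
  right_le : ∀ i, (right i : ℝ) ≤ t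

/-- The value of a step function at time `r`. -/
def StepFunction.eval {t : ℝ} (F : StepFunction t) (r : ℝ) : ℝ :=
  ∑ i, (Ioc (F.left i : ℝ) (F.right i)).indicator (fun _ ↦ F.coeff i) r

/-- The elementary stochastic integral `∑ i, c_i (W_{b_i} - W_{a_i})`. -/
def StepFunction.integral {t : ℝ} (F : StepFunction t) (W : ℝ≥0 → Ω → ℝ) (ω : Ω) : ℝ :=
  ∑ i, F.coeff i * (W (F.right i) ω - W (F.left i) ω)

/-- `ξ` is (a version of) the stochastic integral `∫_0^t f(r) dW(r)` of the deterministic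
square integrable function `f`: the limit in `L²(Ω)` of the elementary integrals of step
functions that converge to `f` in `L²(0, t)`. -/
def IsWienerIntegral (W : ℝ≥0 → Ω → ℝ) (P : Measure Ω) (t : ℝ) (f : ℝ → ℝ) (ξ : Ω → ℝ) : Prop :=
  MemLp f 2 (volume.restrict (Ioc 0 t)) ∧ MemLp ξ 2 P ∧
    ∃ F : ℕ → StepFunction t,
      Tendsto (fun n ↦ eLpNorm (fun r ↦ f r - (F n).eval r) 2 (volume.restrict (Ioc 0 t)))
        atTop (𝓝 0) ∧
      Tendsto (fun n ↦ eLpNorm (fun ω ↦ ξ ω - (F n).integral W ω) 2 P) atTop (𝓝 0)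

/-- `u` is a jointly measurable version, on `𝒪_T`, of the stochastic convolution
`𝒦g(t, x) = ∫_0^t ∫ K(t - r, y) g(r, x - y) dy dW(r)`. The inner integral is required to
converge absolutely for almost every `r ∈ (0, t)`. -/
structure IsStochasticConvolution {d : ℕ} (T : ℝ≥0∞) (K g : SpaceTime d → ℝ)
    (W : ℝ≥0 → Ω → ℝ) (P : Measure Ω) (u : SpaceTime d → Ω → ℝ) : Prop where
  measurable : Measurable (fun q : SpaceTime d × Ω ↦ u q.1 q.2)
  inner_integrable : ∀ X ∈ timeStrip d T, ∀ᵐ r ∂(volume.restrict (Ioc 0 X.1)),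
    Integrable (fun y : EuclideanSpace ℝ (Fin d) ↦ K (X.1 - r, y) * g (r, X.2 - y))
  version : ∀ X ∈ timeStrip d T, IsWienerIntegral W P X.1
    (fun r ↦ ∫ y : EuclideanSpace ℝ (Fin d), K (X.1 - r, y) * g (r, X.2 - y)) (u X)

/-- The stochastic Campanato seminorm `[h]_{ℒ^{p,θ}((D;δ);L^p(Ω))}`, that is, the `p`-th root of
`sup_Q |Q|^{-(1+θ)} 𝔼 ∫_Q ∫_Q |h(Y) - h(Z)|^p dZ dY`
over all `Q = D ∩ Q_c(X)` with `X ∈ D` and `c > 0`. -/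
def campanatoSeminorm {d : ℕ} (p θ : ℝ) (D : Set (SpaceTime d)) (P : Measure Ω)
    (h : SpaceTime d → Ω → ℝ) : ℝ≥0∞ :=
  (⨆ X ∈ D, ⨆ c ∈ Ioi (0 : ℝ),
    (∫⁻ ω, (∫⁻ Y in D ∩ pball X c, ∫⁻ Z in D ∩ pball X c, ‖h Y ω - h Z ω‖ₑ ^ p) ∂P) /
      volume (D ∩ pball X c) ^ (1 + θ)) ^ (1 / p)

end Wiener

end

end StochConv

open StochConv

/-!
The stochastic convolution at `X` is the Wiener integral over `(0, t]` of the deterministic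
function `r ↦ ∫ K(t - r, y) g(r, x - y) dy`, so the increment between two points `X` and `Y` is a
centred Gaussian variable whose standard deviation is the `L²` distance of the two integrands
(extended by zero). The kernel bounds and the Hölder continuity of `g` make this distance at most
a constant times `δ(X, Y) ^ γ`, and for a Gaussian variable this controls moments of every order.
Taking first moments, the convolution is continuous from `𝒪_T` to `L¹(Ω)`, hence has a jointly
measurable version. Taking moments of order `p`, `𝔼 |u(Y) - u(Z)|^p ≲ ρ ^ (γ p)` on a set
`Q = D ∩ Q_c(X)` of diameter at most `2 ρ`; on an `A`-type set one can choose `ρ` with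
`ρ ^ (d + 2) ≲ |Q|`, and integrating over `Q × Q` gives the bound `|Q| ^ (2 + γ p / (d + 2))`.
-/

namespace StochConv

section StepFunction

variable {s t : ℝ}

lemma StepFunction.memLp_eval (F : StepFunction t) (p : ℝ≥0∞) :
    MemLp F.eval p (volume.restrict (Ioc 0 t)) :=
  memLp_finsetSum _ fun _ _ ↦ (memLp_const _).indicator measurableSet_Ioc

lemma StepFunction.eval_eq_zero_of_lt (F : StepFunction t) {r : ℝ} (hr : t < r) : F.eval r = 0 :=
  Finset.sum_eq_zero fun i _ ↦ indicator_of_notMem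
    (fun h ↦ absurd (h.2.trans (F.right_le i)) hr.not_ge) _

/-- The difference of two step functions, obtained by concatenating their lists of steps. -/
instance : Sub (StepFunction t) where
  sub F G :=
    { n := F.n + G.n
      left := Fin.append F.left G.left
      right := Fin.append F.right G.right
      coeff := Fin.append F.coeff (-G.coeff)
      left_le_right := Fin.addCases (by simpa using F.left_le_right)
        (by simpa using G.left_le_right)
      right_le := Fin.addCases (by simpa using F.right_le) (by simpa using G.right_le) }

lemma StepFunction.eval_sub (F G : StepFunction t) : (F - G).eval = F.eval - G.eval := by
  funext r
  change ∑ i, (Ioc ((Fin.append F.left G.left i : ℝ≥0) : ℝ)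
    (Fin.append F.right G.right i : ℝ≥0)).indicator
      (fun _ ↦ Fin.append F.coeff (-G.coeff) i) r = F.eval r - G.eval r
  have hneg (i : Fin G.n) : (Ioc (G.left i : ℝ) (G.right i)).indicator (fun _ ↦ -G.coeff i) r =
      -(Ioc (G.left i : ℝ) (G.right i)).indicator (fun _ ↦ G.coeff i) r :=
    congrFun (indicator_neg _ _) r
  simp [Fin.sum_univ_add, StepFunction.eval, hneg, sub_eq_add_neg]

lemma StepFunction.integral_sub {Ω : Type*} (F G : StepFunction t) (W : ℝ≥0 → Ω → ℝ) :
    (F - G).integral W = F.integral W - G.integral W := by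
  funext ω
  change ∑ i, Fin.append F.coeff (-G.coeff) i *
    (W (Fin.append F.right G.right i) ω - W (Fin.append F.left G.left i) ω) = _
  simp [Fin.sum_univ_add, StepFunction.integral, sub_eq_add_neg]

/-- A step function on `(0, s]`, regarded as a step function on the longer interval `(0, t]`. -/
def StepFunction.castLE (hst : s ≤ t) (F : StepFunction s) : StepFunction t :=
  { F with right_le := fun i ↦ (F.right_le i).trans hst }

lemma StepFunction.integral_eq_sum {Ω : Type*} (F : StepFunction t) (W : ℝ≥0 → Ω → ℝ) (ω : Ω) :
    F.integral W ω = ∑ i : Fin F.n ⊕ Fin F.n, Sum.elim F.coeff (-F.coeff) i *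
      W (Sum.elim F.right F.left i) ω := by
  simp [StepFunction.integral, mul_sub, Finset.sum_sub_distrib, ← sub_eq_add_neg]

lemma StepFunction.eval_eq_sum (F : StepFunction t) {r : ℝ} (hr : 0 < r) :
    F.eval r = ∑ i : Fin F.n ⊕ Fin F.n, Sum.elim F.coeff (-F.coeff) i *
      (Ioc 0 ((Sum.elim F.right F.left i : ℝ≥0) : ℝ)).indicator 1 r := by
  simp only [StepFunction.eval, Fintype.sum_sum_type, Sum.elim_inl, Sum.elim_inr,
    ← Finset.sum_add_distrib]
  refine Finset.sum_congr rfl fun i _ ↦ ?_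
  have := NNReal.coe_le_coe.2 (F.left_le_right i)
  by_cases h1 : r ≤ F.left i <;> by_cases h2 : r ≤ F.right i
  · simp [indicator, hr, h1, h2]
  · linarith
  · simp [indicator, hr, h1, h2, not_le.1 h1]
  · simp [indicator, hr, h1, h2]

end StepFunction

section GaussianMoments

lemma toNNReal_integral_sq_eq {α : Type*} [MeasurableSpace α] {μ : Measure α} {f : α → ℝ}
    (hf : MemLp f 2 μ) : (∫ x, f x ^ 2 ∂μ).toNNReal = (eLpNorm f 2 μ).toNNReal ^ 2 := by
  have h0 : 0 ≤ ∫ x, f x ^ 2 ∂μ := integral_nonneg fun _ ↦ sq_nonneg _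
  rw [hf.eLpNorm_eq_integral_rpow_norm two_ne_zero ENNReal.ofNat_ne_top]
  simp only [ENNReal.toReal_ofNat, Real.rpow_ofNat, Real.norm_eq_abs, sq_abs]
  rw [ENNReal.ofReal, ENNReal.toNNReal_coe, ← Real.toNNReal_pow (by positivity)]
  exact congrArg _ (Real.rpow_inv_natCast_pow h0 two_ne_zero).symm

lemma eLpNorm_id_gaussianReal_sq (p : ℝ≥0∞) (c : ℝ≥0) :
    eLpNorm id p (gaussianReal 0 (c ^ 2)) = eLpNorm id p (gaussianReal 0 1) * c := by
  have h : (gaussianReal 0 1).map ((c : ℝ) * ·) = gaussianReal 0 (c ^ 2) := by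
    rw [gaussianReal_map_const_mul, mul_zero, mul_one]
    rfl
  rw [← h, eLpNorm_map_measure aestronglyMeasurable_id (by fun_prop), mul_comm]
  exact (eLpNorm_const_smul (c : ℝ) id p _).trans (by simp)

lemma eLpNorm_eq_of_hasLaw_gaussianReal {Ω : Type*} [MeasurableSpace Ω] {P : Measure Ω}
    {ξ : Ω → ℝ} {c : ℝ≥0} (hξ : HasLaw ξ (gaussianReal 0 (c ^ 2)) P) (p : ℝ≥0∞) :
    eLpNorm ξ p P = eLpNorm id p (gaussianReal 0 1) * c := by
  rw [← eLpNorm_id_gaussianReal_sq, ← hξ.map_eq,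
    eLpNorm_map_measure aestronglyMeasurable_id hξ.aemeasurable, Function.id_comp]

lemma eLpNorm_id_gaussianReal_ne_top {p : ℝ≥0∞} (hp : p ≠ ∞) :
    eLpNorm id p (gaussianReal 0 1) ≠ ∞ :=
  (memLp_id_gaussianReal' p hp).eLpNorm_ne_top

end GaussianMoments

section WienerIsometry

variable {Ω : Type*} [MeasurableSpace Ω] {P : Measure Ω} {T : ℝ≥0∞} {W : ℝ≥0 → Ω → ℝ}

lemma IsWienerProcess.hasLaw_eval (hW : IsWienerProcess T W P) {t : ℝ≥0} (ht : (t : ℝ≥0∞) ≤ T) :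
    HasLaw (W t) (gaussianReal 0 t) P := by
  have h := hW.gaussian 0 t zero_le ht
  rw [tsub_zero] at h
  refine h.congr ?_
  filter_upwards [hW.zero] with ω hω
  rw [hω, sub_zero]

lemma IsWienerProcess.isGaussianProcess (hW : IsWienerProcess T W P) :
    IsGaussianProcess (fun t : {t : ℝ≥0 // (t : ℝ≥0∞) ≤ T} ↦ W t) P := by
  let _ : OrderBot {t : ℝ≥0 // (t : ℝ≥0∞) ≤ T} :=
    { bot := ⟨0, by simp⟩, bot_le := fun _ ↦ Subtype.mk_le_mk.2 zero_le }
  exact HasIndepIncrements.isGaussianProcess (fun t ↦ (hW.hasLaw_eval t.2).hasGaussianLaw)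
    hW.zero hW.indep

lemma IsWienerProcess.memLp_two (hW : IsWienerProcess T W P) {t : ℝ≥0} (ht : (t : ℝ≥0∞) ≤ T) :
    MemLp (W t) 2 P :=
  (hW.hasLaw_eval ht).hasGaussianLaw.memLp_two

lemma IsWienerProcess.variance_eval (hW : IsWienerProcess T W P) {t : ℝ≥0}
    (ht : (t : ℝ≥0∞) ≤ T) : Var[W t; P] = t := by
  rw [(hW.hasLaw_eval ht).variance_eq, variance_id_gaussianReal]

lemma IsWienerProcess.integral_eval (hW : IsWienerProcess T W P) {t : ℝ≥0}
    (ht : (t : ℝ≥0∞) ≤ T) : ∫ ω, W t ω ∂P = 0 := by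
  rw [(hW.hasLaw_eval ht).integral_eq, integral_id_gaussianReal]

lemma IsWienerProcess.covariance_of_le [IsFiniteMeasure P] (hW : IsWienerProcess T W P)
    {s t : ℝ≥0} (hst : s ≤ t) (ht : (t : ℝ≥0∞) ≤ T) : cov[W s, W t; P] = s := by
  have hs : (s : ℝ≥0∞) ≤ T := (ENNReal.coe_le_coe.2 hst).trans ht
  have hvar : Var[fun ω ↦ W t ω - W s ω; P] = (t - s : ℝ≥0) := by
    rw [(hW.gaussian s t hst ht).variance_eq, variance_id_gaussianReal]
  rw [variance_fun_sub (hW.memLp_two ht) (hW.memLp_two hs), hW.variance_eval ht,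
    hW.variance_eval hs, NNReal.coe_sub hst, covariance_comm] at hvar
  linarith

lemma IsWienerProcess.covariance_eval [IsFiniteMeasure P] (hW : IsWienerProcess T W P)
    {s t : ℝ≥0} (hs : (s : ℝ≥0∞) ≤ T) (ht : (t : ℝ≥0∞) ≤ T) :
    cov[W s, W t; P] = min (s : ℝ) t := by
  rcases le_total s t with h | h
  · rw [hW.covariance_of_le h ht, min_eq_left (by exact_mod_cast h)]
  · rw [covariance_comm, hW.covariance_of_le h hs, min_eq_right (by exact_mod_cast h)]

lemma integral_indicator_Ioc_mul_indicator_Ioc {a b t : ℝ} (ha : 0 ≤ a) (hb : 0 ≤ b)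
    (hat : a ≤ t) :
    ∫ r in Ioc 0 t, (Ioc 0 a).indicator (1 : ℝ → ℝ) r * (Ioc 0 b).indicator 1 r = min a b := by
  simp_rw [← inter_indicator_mul, Pi.one_apply, mul_one]
  rw [Ioc_inter_Ioc, max_self, setIntegral_indicator measurableSet_Ioc, Ioc_inter_Ioc, max_self,
    min_eq_right ((min_le_left a b).trans hat)]
  simp [le_min ha hb]

lemma integral_sq_sum_indicator {ι : Type*} [Fintype ι] {t : ℝ} (τ : ι → ℝ≥0)
    (hτ : ∀ i, (τ i : ℝ) ≤ t) (e : ι → ℝ) :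
    ∫ r in Ioc 0 t, (∑ i, e i * (Ioc 0 (τ i : ℝ)).indicator 1 r) ^ 2 =
      ∑ i, ∑ j, e i * (e j * min (τ i : ℝ) (τ j)) := by
  have hint : ∀ i j, IntegrableOn (fun r ↦ e i * (Ioc 0 (τ i : ℝ)).indicator 1 r *
      (e j * (Ioc 0 (τ j : ℝ)).indicator 1 r)) (Ioc 0 t) := fun i j ↦
    have hmem (k) : MemLp (fun r ↦ e k * (Ioc 0 (τ k : ℝ)).indicator 1 r) 2
        (volume.restrict (Ioc 0 t)) :=
      ((memLp_const (1 : ℝ)).indicator measurableSet_Ioc).const_mul _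
    (hmem i).integrable_mul (hmem j)
  simp_rw [sq, Finset.sum_mul_sum]
  rw [integral_finsetSum _ fun i _ ↦ integrable_finsetSum _ fun j _ ↦ hint i j]
  refine Finset.sum_congr rfl fun i _ ↦ ?_
  rw [integral_finsetSum _ fun j _ ↦ hint i j]
  refine Finset.sum_congr rfl fun j _ ↦ ?_
  simp_rw [mul_mul_mul_comm, integral_const_mul]
  rw [← mul_assoc]
  exact congrArg _ (integral_indicator_Ioc_mul_indicator_Ioc (τ i).2 (τ j).2 (hτ i))

lemma IsWienerProcess.hasGaussianLaw_sum (hW : IsWienerProcess T W P) {ι : Type*} [Fintype ι]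
    (τ : ι → ℝ≥0) (hτ : ∀ i, (τ i : ℝ≥0∞) ≤ T) (e : ι → ℝ) :
    HasGaussianLaw (fun ω ↦ ∑ i, e i * W (τ i) ω) P := by
  classical
  let τ' (i : ι) : {t : ℝ≥0 // (t : ℝ≥0∞) ≤ T} := ⟨τ i, hτ i⟩
  have h := (hW.isGaussianProcess.hasGaussianLaw (Finset.univ.image τ')).map
    (∑ i, e i • ContinuousLinearMap.proj ⟨τ' i, Finset.mem_image_of_mem τ' (Finset.mem_univ i)⟩)
  refine h.congr (ae_of_all _ fun ω ↦ ?_)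
  simp [sum_apply, τ']

lemma IsWienerProcess.hasLaw_sum [IsProbabilityMeasure P] (hW : IsWienerProcess T W P)
    {ι : Type*} [Fintype ι] (τ : ι → ℝ≥0) (hτ : ∀ i, (τ i : ℝ≥0∞) ≤ T) (e : ι → ℝ) :
    HasLaw (fun ω ↦ ∑ i, e i * W (τ i) ω) (gaussianReal 0
      (∑ i, ∑ j, e i * (e j * min (τ i : ℝ) (τ j))).toNNReal) P := by
  have hG := hW.hasGaussianLaw_sum τ hτ e
  have hm : ∀ i, MemLp (fun ω ↦ e i * W (τ i) ω) 2 P := fun i ↦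
    (hW.memLp_two (hτ i)).const_mul _
  have hmean : ∫ ω, ∑ i, e i * W (τ i) ω ∂P = 0 := by
    rw [integral_finsetSum _ fun i _ ↦ (hm i).integrable one_le_two]
    simp_rw [integral_const_mul, hW.integral_eval (hτ _), mul_zero, Finset.sum_const_zero]
  have hvar : Var[fun ω ↦ ∑ i, e i * W (τ i) ω; P] =
      ∑ i, ∑ j, e i * (e j * min (τ i : ℝ) (τ j)) := by
    rw [← covariance_self hG.aemeasurable, covariance_fun_sum_fun_sum hm hm]
    simp_rw [covariance_const_mul_left, covariance_const_mul_right,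
      hW.covariance_eval (hτ _) (hτ _)]
  exact ⟨hG.aemeasurable, by rw [hG.map_eq_gaussianReal, hmean, hvar]⟩

lemma IsWienerProcess.hasLaw_stepFunction [IsProbabilityMeasure P] (hW : IsWienerProcess T W P)
    {t : ℝ} (ht : ENNReal.ofReal t ≤ T) (F : StepFunction t) :
    HasLaw (F.integral W)
      (gaussianReal 0 ((eLpNorm F.eval 2 (volume.restrict (Ioc 0 t))).toNNReal ^ 2)) P := by
  have hle : ∀ i, ((Sum.elim F.right F.left i : ℝ≥0) : ℝ) ≤ t := by
    rintro (i | i)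
    · exact F.right_le i
    · exact (NNReal.coe_le_coe.2 (F.left_le_right i)).trans (F.right_le i)
  have hT : ∀ i, ((Sum.elim F.right F.left i : ℝ≥0) : ℝ≥0∞) ≤ T := fun i ↦
    (ENNReal.ofReal_coe_nnreal.symm.trans_le (ENNReal.ofReal_le_ofReal (hle i))).trans ht
  have h := hW.hasLaw_sum _ hT (Sum.elim F.coeff (-F.coeff))
  rw [← integral_sq_sum_indicator _ hle, setIntegral_congr_fun (g := fun r ↦ F.eval r ^ 2)
    measurableSet_Ioc fun r hr ↦ by simp only [F.eval_eq_sum hr.1],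
    toNNReal_integral_sq_eq (F.memLp_eval 2)] at h
  exact h.congr (ae_of_all _ fun ω ↦ F.integral_eq_sum W ω)

lemma IsWienerProcess.eLpNorm_stepFunction [IsProbabilityMeasure P] (hW : IsWienerProcess T W P)
    {t : ℝ} (ht : ENNReal.ofReal t ≤ T) (F : StepFunction t) (p : ℝ≥0∞) :
    eLpNorm (F.integral W) p P =
      eLpNorm id p (gaussianReal 0 1) * eLpNorm F.eval 2 (volume.restrict (Ioc 0 t)) := by
  rw [eLpNorm_eq_of_hasLaw_gaussianReal (hW.hasLaw_stepFunction ht F),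
    ENNReal.coe_toNNReal (F.memLp_eval 2).2.ne]

lemma IsWienerProcess.memLp_stepFunction [IsProbabilityMeasure P] (hW : IsWienerProcess T W P)
    {t : ℝ} (ht : ENNReal.ofReal t ≤ T) (F : StepFunction t) {p : ℝ≥0∞} (hp : p ≠ ∞) :
    MemLp (F.integral W) p P := by
  refine ⟨(hW.hasLaw_stepFunction ht F).aemeasurable.aestronglyMeasurable, ?_⟩
  rw [hW.eLpNorm_stepFunction ht]
  exact ENNReal.mul_lt_top (eLpNorm_id_gaussianReal_ne_top hp).lt_top (F.memLp_eval 2).2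

end WienerIsometry

section StepFunctionDensity

variable {t : ℝ}

/-- The step function that samples `g` at the right endpoints of the partition of `(0, t]` into
`n` intervals of equal length. -/
noncomputable def gridStepFunction (ht : 0 ≤ t) (n : ℕ) (g : ℝ → ℝ) : StepFunction t where
  n := n
  left i := i * (t.toNNReal / n)
  right i := (i + 1) * (t.toNNReal / n)
  coeff i := g ((i + 1) * (t / n))
  left_le_right _ := by gcongr; simp
  right_le i := by
    have hn : (n : ℝ) ≠ 0 := by exact_mod_cast i.pos.ne'
    have hi : ((i : ℕ) : ℝ) + 1 ≤ n := by exact_mod_cast i.2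
    calc _ = ((i : ℕ) + 1) * (t / n) := by push_cast [Real.coe_toNNReal t ht]; rfl
      _ ≤ n * (t / n) := by gcongr
      _ = t := by field_simp

lemma eval_gridStepFunction (ht : 0 ≤ t) {n : ℕ} (hn : n ≠ 0) (g : ℝ → ℝ) {r : ℝ}
    (hr : r ∈ Ioc 0 t) :
    (gridStepFunction ht n g).eval r = g (⌈r / (t / n)⌉₊ * (t / n)) := by
  have hn' : (0 : ℝ) < n := by exact_mod_cast hn.bot_lt
  have hh : 0 < t / n := div_pos (hr.1.trans_le hr.2) hn'
  have hceil : ⌈r / (t / n)⌉₊ - 1 < n := by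
    have : ⌈r / (t / n)⌉₊ ≤ n := Nat.ceil_le.2 (by
      rw [div_le_iff₀ hh, mul_div_cancel₀ _ hn'.ne']; exact hr.2)
    lia
  have hpos : ⌈r / (t / n)⌉₊ - 1 + 1 = ⌈r / (t / n)⌉₊ :=
    Nat.sub_add_cancel (Nat.ceil_pos.2 (div_pos hr.1 hh))
  have hmem (i : ℕ) : r ∈ Ioc (i * (t / n)) ((i + 1) * (t / n)) ↔ ⌈r / (t / n)⌉₊ = i + 1 := by
    rw [mem_Ioc, ← lt_div_iff₀ hh, ← div_le_iff₀ hh, Nat.ceil_eq_iff i.succ_ne_zero]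
    push_cast [Nat.add_sub_cancel]
    rfl
  have hsum : (gridStepFunction ht n g).eval r =
      ∑ i : Fin n, if ⌈r / (t / n)⌉₊ = i + 1 then g ((i + 1) * (t / n)) else 0 := by
    simp only [StepFunction.eval, gridStepFunction, indicator_apply, NNReal.coe_mul,
      NNReal.coe_add, NNReal.coe_natCast, NNReal.coe_one, NNReal.coe_div, Real.coe_toNNReal t ht,
      hmem]
    rfl
  rw [hsum, Finset.sum_eq_single_of_mem ⟨_, hceil⟩ (Finset.mem_univ _)
    fun i _ hi ↦ if_neg fun h ↦ hi (Fin.ext (by simp [h])), if_pos hpos.symm]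
  congr 2
  exact_mod_cast hpos

lemma tendstoUniformlyOn_gridStepFunction (ht : 0 ≤ t) {g : ℝ → ℝ} (hg : UniformContinuous g) :
    TendstoUniformlyOn (fun n ↦ (gridStepFunction ht n g).eval) g atTop (Ioc 0 t) := by
  rw [Metric.tendstoUniformlyOn_iff]
  intro ε hε
  obtain ⟨δ, hδ, hgδ⟩ := Metric.uniformContinuous_iff.1 hg ε hε
  filter_upwards [(tendsto_const_div_atTop_nhds_zero_nat t).eventually_lt_const hδ,
    eventually_ne_atTop 0] with n hn hn0 r hr
  have hh : 0 < t / n := div_pos (hr.1.trans_le hr.2) (by exact_mod_cast hn0.bot_lt)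
  rw [eval_gridStepFunction ht hn0 g hr]
  refine hgδ ?_
  have hle := (div_le_iff₀ hh).1 (Nat.le_ceil (r / (t / n)))
  have hlt := (mul_lt_mul_iff_left₀ hh).2 (Nat.ceil_lt_add_one (div_pos hr.1 hh).le)
  rw [add_mul, div_mul_cancel₀ _ hh.ne', one_mul] at hlt
  rw [Real.dist_eq, abs_sub_comm, abs_of_nonneg (sub_nonneg.2 hle)]
  linarith

lemma exists_stepFunction_eLpNorm_sub_le_of_uniformContinuous (ht : 0 ≤ t) {g : ℝ → ℝ}
    (hg : UniformContinuous g) (p : ℝ≥0∞) {ε : ℝ≥0∞} (hε : ε ≠ 0) :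
    ∃ F : StepFunction t, eLpNorm (g - F.eval) p (volume.restrict (Ioc 0 t)) ≤ ε := by
  obtain ⟨η, hη, hηε⟩ := ENNReal.exists_nnreal_pos_mul_lt
    (a := volume.restrict (Ioc 0 t) univ ^ p.toReal⁻¹)
    (ENNReal.rpow_ne_top_of_nonneg (by positivity) (measure_ne_top _ _)) hε
  obtain ⟨n, hn⟩ := (Metric.tendstoUniformlyOn_iff.1
    (tendstoUniformlyOn_gridStepFunction ht hg) η hη).exists
  refine ⟨gridStepFunction ht n g, ?_⟩
  have hbound : ∀ᵐ r ∂volume.restrict (Ioc 0 t), ‖(g - (gridStepFunction ht n g).eval) r‖ ≤ η :=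
    (ae_restrict_mem measurableSet_Ioc).mono fun r hr ↦ (hn r hr).le
  refine (eLpNorm_le_of_ae_bound hbound).trans ?_
  rw [ENNReal.ofReal_coe_nnreal, mul_comm]
  exact hηε.le

lemma exists_stepFunction_eLpNorm_sub_le {p : ℝ≥0∞} (hp : 1 ≤ p) (hp' : p ≠ ∞) {f : ℝ → ℝ}
    (hf : MemLp f p (volume.restrict (Ioc 0 t))) {ε : ℝ≥0∞} (hε : ε ≠ 0) :
    ∃ F : StepFunction t, eLpNorm (f - F.eval) p (volume.restrict (Ioc 0 t)) ≤ ε := by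
  rcases le_or_gt 0 t with ht | ht
  · obtain ⟨g, hgc, hfg, hg, hgp⟩ :=
      hf.exists_hasCompactSupport_eLpNorm_sub_le hp' (ENNReal.half_pos hε).ne'
    obtain ⟨F, hF⟩ := exists_stepFunction_eLpNorm_sub_le_of_uniformContinuous ht
      (hgc.uniformContinuous_of_continuous hg) p (ENNReal.half_pos hε).ne'
    refine ⟨F, ?_⟩
    rw [← sub_add_sub_cancel f g, ← ENNReal.add_halves ε]
    exact (eLpNorm_add_le (hf.1.sub hgp.1) (hgp.1.sub (F.memLp_eval p).1) hp).trans
      (add_le_add hfg hF)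
  · refine ⟨⟨0, Fin.elim0, Fin.elim0, Fin.elim0, fun i ↦ i.elim0, fun i ↦ i.elim0⟩, ?_⟩
    simp [Ioc_eq_empty ht.not_gt]

end StepFunctionDensity

section WienerIntegral

variable {Ω : Type*} [MeasurableSpace Ω] {P : Measure Ω} {T : ℝ≥0∞} {W : ℝ≥0 → Ω → ℝ}
  {s t : ℝ} {f g : ℝ → ℝ} {ξ η : Ω → ℝ}

lemma tendsto_toNNReal_eLpNorm {α : Type*} [MeasurableSpace α] {μ : Measure α} {p : ℝ≥0∞}
    [Fact (1 ≤ p)] {F : ℕ → α → ℝ} {f : α → ℝ} (hF : ∀ n, MemLp (F n) p μ) (hf : MemLp f p μ)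
    (hlim : Tendsto (fun n ↦ eLpNorm (F n - f) p μ) atTop (𝓝 0)) :
    Tendsto (fun n ↦ (eLpNorm (F n) p μ).toNNReal) atTop (𝓝 (eLpNorm f p μ).toNNReal) := by
  have h := ((Lp.tendsto_Lp_iff_tendsto_eLpNorm'' F hF f hf).2 hlim).nnnorm
  simpa only [Lp.nnnorm_toLp] using h

lemma IsWienerIntegral.hasLaw [IsProbabilityMeasure P] (hW : IsWienerProcess T W P)
    (ht : ENNReal.ofReal t ≤ T) (hf : IsWienerIntegral W P t f ξ) :
    HasLaw ξ (gaussianReal 0 ((eLpNorm f 2 (volume.restrict (Ioc 0 t))).toNNReal ^ 2)) P := by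
  obtain ⟨hf₂, hξ, F, hFf, hFξ⟩ := hf
  have hm n : MemLp ((F n).integral W) 2 P :=
    hW.memLp_stepFunction ht (F n) ENNReal.ofNat_ne_top
  have hvar := tendsto_toNNReal_eLpNorm (fun n ↦ (F n).memLp_eval 2) hf₂
    (by simp_rw [eLpNorm_sub_comm _ f]; exact hFf)
  have hlim : TendstoInMeasure P (fun n ↦ (F n).integral W) atTop ξ :=
    tendstoInMeasure_of_tendsto_eLpNorm two_ne_zero (fun n ↦ (hm n).1) hξ.1
      (by simp_rw [eLpNorm_sub_comm _ ξ]; exact hFξ)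
  have hdist := hlim.tendstoInDistribution fun n ↦ (hm n).1.aemeasurable
  refine ⟨hξ.1.aemeasurable, Measure.ext_of_charFun (funext fun θ ↦ ?_)⟩
  have h := ProbabilityMeasure.tendsto_iff_tendsto_charFun.1 hdist.tendsto θ
  refine tendsto_nhds_unique h ?_
  simp_rw [ProbabilityMeasure.coe_mk, (hW.hasLaw_stepFunction ht _).map_eq, charFun_gaussianReal]
  refine (Complex.continuous_exp.tendsto _).comp (tendsto_const_nhds.sub ?_)
  refine Tendsto.div_const (Tendsto.mul_const _ ?_) _
  exact (Complex.continuous_ofReal.tendsto _).comp ((NNReal.tendsto_coe.2 (hvar.pow 2)))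

lemma IsWienerIntegral.eLpNorm_eq [IsProbabilityMeasure P] (hW : IsWienerProcess T W P)
    (ht : ENNReal.ofReal t ≤ T) (hf : IsWienerIntegral W P t f ξ) (p : ℝ≥0∞) :
    eLpNorm ξ p P =
      eLpNorm id p (gaussianReal 0 1) * eLpNorm f 2 (volume.restrict (Ioc 0 t)) := by
  rw [eLpNorm_eq_of_hasLaw_gaussianReal (hf.hasLaw hW ht), ENNReal.coe_toNNReal hf.1.2.ne]

lemma exists_isWienerIntegral [IsProbabilityMeasure P] (hW : IsWienerProcess T W P)
    (ht : ENNReal.ofReal t ≤ T) (hf : MemLp f 2 (volume.restrict (Ioc 0 t))) :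
    ∃ ξ, IsWienerIntegral W P t f ξ := by
  choose F hF using fun n : ℕ ↦ exists_stepFunction_eLpNorm_sub_le one_le_two
    ENNReal.ofNat_ne_top hf (ENNReal.inv_ne_zero.2 (ENNReal.natCast_ne_top n))
  have hFf : Tendsto (fun n ↦ eLpNorm (f - (F n).eval) 2 (volume.restrict (Ioc 0 t))) atTop
      (𝓝 0) :=
    tendsto_of_tendsto_of_tendsto_of_le_of_le tendsto_const_nhds
      ENNReal.tendsto_inv_nat_nhds_zero (fun _ ↦ zero_le) hF
  have hm n : MemLp ((F n).integral W) 2 P :=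
    hW.memLp_stepFunction ht (F n) ENNReal.ofNat_ne_top
  have hdist (i j : ℕ) : dist ((hm i).toLp _) ((hm j).toLp _) =
      (eLpNorm id 2 (gaussianReal 0 1)).toReal *
        dist (((F i).memLp_eval 2).toLp _) (((F j).memLp_eval 2).toLp _) := by
    simp only [dist_edist, Lp.edist_toLp_toLp, ← StepFunction.integral_sub,
      ← StepFunction.eval_sub, hW.eLpNorm_stepFunction ht, ENNReal.toReal_mul]
  have hcauchy : CauchySeq fun n ↦ (hm n).toLp _ := by
    have hconv : Tendsto (fun n ↦ ((F n).memLp_eval 2).toLp _) atTop (𝓝 (hf.toLp f)) :=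
      (Lp.tendsto_Lp_iff_tendsto_eLpNorm'' _ _ f hf).2
        (by simpa only [eLpNorm_sub_comm _ f] using hFf)
    have h := cauchySeq_iff_tendsto_dist_atTop_0.1 hconv.cauchySeq
    rw [cauchySeq_iff_tendsto_dist_atTop_0]
    simpa only [hdist, mul_zero] using h.const_mul _
  obtain ⟨ξ, hξ⟩ := cauchySeq_tendsto_of_complete hcauchy
  refine ⟨ξ, hf, Lp.memLp ξ, F, hFf, ?_⟩
  have h := (Lp.tendsto_Lp_iff_tendsto_eLpNorm'' _ hm ξ (Lp.memLp ξ)).1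
    (by simpa only [Lp.toLp_coeFn] using hξ)
  simp_rw [eLpNorm_sub_comm _ ξ] at h
  exact h

lemma indicator_sub_eval_castLE (hst : s ≤ t) (f : ℝ → ℝ) (F : StepFunction s) {r : ℝ}
    (hr : 0 < r) :
    ((Ioc 0 s).indicator f - (F.castLE hst).eval) r = (Ioc 0 s).indicator (f - F.eval) r := by
  by_cases h : r ∈ Ioc 0 s
  · simp only [Pi.sub_apply, indicator_of_mem h]
    rfl
  · have hF : (F.castLE hst).eval r = 0 := F.eval_eq_zero_of_lt (not_le.1 fun h' ↦ h ⟨hr, h'⟩)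
    simp only [Pi.sub_apply, indicator_of_notMem h, hF, sub_zero]

lemma eLpNorm_indicator_Ioc (hst : s ≤ t) (f : ℝ → ℝ) (p : ℝ≥0∞) :
    eLpNorm ((Ioc 0 s).indicator f) p (volume.restrict (Ioc 0 t)) =
      eLpNorm f p (volume.restrict (Ioc 0 s)) := by
  rw [eLpNorm_indicator_eq_eLpNorm_restrict measurableSet_Ioc,
    Measure.restrict_restrict_of_subset (Ioc_subset_Ioc_right hst)]

lemma memLp_indicator_Ioc (hst : s ≤ t) {p : ℝ≥0∞} (hf : MemLp f p (volume.restrict (Ioc 0 s))) :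
    MemLp ((Ioc 0 s).indicator f) p (volume.restrict (Ioc 0 t)) := by
  rwa [memLp_indicator_iff_restrict measurableSet_Ioc,
    Measure.restrict_restrict_of_subset (Ioc_subset_Ioc_right hst)]

lemma tendsto_eLpNorm_sub_sub {α : Type*} [MeasurableSpace α] {μ : Measure α} {p : ℝ≥0∞}
    (hp : 1 ≤ p) {f g : α → ℝ} {F G : ℕ → α → ℝ} (hf : MemLp f p μ) (hg : MemLp g p μ)
    (hF : ∀ n, MemLp (F n) p μ) (hG : ∀ n, MemLp (G n) p μ)
    (hFf : Tendsto (fun n ↦ eLpNorm (f - F n) p μ) atTop (𝓝 0))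
    (hGg : Tendsto (fun n ↦ eLpNorm (g - G n) p μ) atTop (𝓝 0)) :
    Tendsto (fun n ↦ eLpNorm ((f - g) - (F n - G n)) p μ) atTop (𝓝 0) := by
  refine tendsto_of_tendsto_of_tendsto_of_le_of_le tendsto_const_nhds
    (by simpa only [add_zero] using hFf.add hGg) (fun _ ↦ zero_le) fun n ↦ ?_
  rw [sub_sub_sub_comm]
  exact eLpNorm_sub_le (hf.1.sub (hF n).1) (hg.1.sub (hG n).1) hp

lemma IsWienerIntegral.indicator (hst : s ≤ t) (hg : IsWienerIntegral W P s g η) :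
    IsWienerIntegral W P t ((Ioc 0 s).indicator g) η := by
  obtain ⟨hg₂, hη, G, hGg, hGη⟩ := hg
  refine ⟨memLp_indicator_Ioc hst hg₂, hη, fun n ↦ (G n).castLE hst, ?_, hGη⟩
  convert hGg using 2 with n
  rw [← eLpNorm_indicator_Ioc hst]
  exact eLpNorm_congr_ae ((ae_restrict_mem measurableSet_Ioc).mono fun r hr ↦
    indicator_sub_eval_castLE hst g (G n) hr.1)

lemma IsWienerIntegral.sub [IsProbabilityMeasure P] (hW : IsWienerProcess T W P)
    (ht : ENNReal.ofReal t ≤ T) (hf : IsWienerIntegral W P t f ξ)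
    (hg : IsWienerIntegral W P t g η) : IsWienerIntegral W P t (f - g) (ξ - η) := by
  obtain ⟨hf₂, hξ, F, hFf, hFξ⟩ := hf
  obtain ⟨hg₂, hη, G, hGg, hGη⟩ := hg
  have hm (F : StepFunction t) := hW.memLp_stepFunction ht F (p := 2) ENNReal.ofNat_ne_top
  refine ⟨hf₂.sub hg₂, hξ.sub hη, fun n ↦ F n - G n, ?_, ?_⟩
  · simp only [StepFunction.eval_sub]
    exact tendsto_eLpNorm_sub_sub one_le_two hf₂ hg₂ (fun n ↦ (F n).memLp_eval 2)
      (fun n ↦ (G n).memLp_eval 2) hFf hGg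
  · simp only [StepFunction.integral_sub]
    exact tendsto_eLpNorm_sub_sub one_le_two hξ hη (fun n ↦ hm (F n)) (fun n ↦ hm (G n)) hFξ hGη

lemma IsWienerIntegral.congr (hf : IsWienerIntegral W P t f ξ) (h : ξ =ᵐ[P] η) :
    IsWienerIntegral W P t f η := by
  obtain ⟨hf₂, hξ, F, hFf, hFξ⟩ := hf
  exact ⟨hf₂, hξ.ae_eq h, F, hFf,
    hFξ.congr fun n ↦ eLpNorm_congr_ae (h.sub (EventuallyEq.refl _ _))⟩

end WienerIntegral

section MeasurableVersion

lemma exists_seq_forall_exists_measurable_dist_lt {E M : Type*} [MeasurableSpace E]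
    [PseudoMetricSpace M] [Nonempty M] {f : E → M} (hf : StronglyMeasurable f) :
    ∃ e : ℕ → M, ∀ ε > 0, ∃ N : E → ℕ, Measurable N ∧ ∀ x, dist (f x) (e (N x)) < ε := by
  classical
  obtain ⟨c, hc, hfc⟩ := hf.isSeparable_range
  obtain ⟨e, he⟩ := (hc.insert (Classical.arbitrary M)).exists_eq_range (insert_nonempty _ _)
  refine ⟨e, fun ε hε ↦ ?_⟩
  have hdense (x : E) : ∃ k, dist (f x) (e k) < ε := by
    have hx : f x ∈ closure (range e) :=
      he ▸ closure_mono (subset_insert _ _) (hfc (mem_range_self x))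
    exact Metric.mem_closure_range_iff.1 hx ε hε
  exact ⟨fun x ↦ Nat.find (hdense x), measurable_find hdense fun k ↦
    measurableSet_lt (hf.dist stronglyMeasurable_const).measurable measurable_const,
    fun x ↦ Nat.find_spec (hdense x)⟩

lemma ae_tendsto_of_tsum_eLpNorm_one_ne_top {α F : Type*} [MeasurableSpace α] {μ : Measure α}
    [NormedAddCommGroup F] {f : ℕ → α → F} {g : α → F}
    (hf : ∀ n, AEStronglyMeasurable (f n) μ) (hg : AEStronglyMeasurable g μ)
    (hfg : ∑' n, eLpNorm (f n - g) 1 μ ≠ ∞) :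
    ∀ᵐ x ∂μ, Tendsto (fun n ↦ f n x) atTop (𝓝 (g x)) := by
  have hm n : AEMeasurable (fun x ↦ ‖(f n - g) x‖ₑ) μ := ((hf n).sub hg).enorm
  simp_rw [eLpNorm_one_eq_lintegral_enorm, ← lintegral_tsum hm] at hfg
  filter_upwards [ae_lt_top' (AEMeasurable.tsum hm) hfg] with x hx
  simpa only [tendsto_iff_edist_tendsto_0, edist_eq_enorm_sub, Pi.sub_apply]
    using ENNReal.tendsto_atTop_zero_of_tsum_ne_top hx.ne

lemma exists_measurable_version {E Ω : Type*} [MeasurableSpace E] [MeasurableSpace Ω]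
    {P : Measure Ω} {f : E → Lp ℝ 1 P} (hf : StronglyMeasurable f) :
    ∃ u : E → Ω → ℝ, Measurable (fun q : E × Ω ↦ u q.1 q.2) ∧ ∀ x, u x =ᵐ[P] f x := by
  obtain ⟨e, he⟩ := exists_seq_forall_exists_measurable_dist_lt hf
  choose N hNm hN using fun n : ℕ ↦ he (2⁻¹ ^ n) (by positivity)
  have he_meas : Measurable fun q : Ω × ℕ ↦ e q.2 q.1 :=
    measurable_from_prod_countable_left fun k ↦ (Lp.stronglyMeasurable (e k)).measurable
  refine ⟨fun x ω ↦ limsup (fun n ↦ e (N n x) ω) atTop, Measurable.limsup fun n ↦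
    he_meas.comp (measurable_snd.prodMk ((hNm n).comp measurable_fst)), fun x ↦ ?_⟩
  have hle n : eLpNorm (⇑(e (N n x)) - ⇑(f x)) 1 P ≤ 2⁻¹ ^ n := by
    rw [← Lp.edist_def, edist_dist, dist_comm]
    refine (ENNReal.ofReal_le_ofReal (hN n x).le).trans_eq ?_
    rw [ENNReal.ofReal_pow (by positivity), ENNReal.ofReal_inv_of_pos two_pos,
      ENNReal.ofReal_ofNat]
  have hsum : ∑' n, eLpNorm (⇑(e (N n x)) - ⇑(f x)) 1 P ≠ ∞ :=
    ne_top_of_le_ne_top (by simp [ENNReal.tsum_geometric]) (ENNReal.tsum_le_tsum hle)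
  filter_upwards [ae_tendsto_of_tsum_eLpNorm_one_ne_top (fun n ↦ Lp.aestronglyMeasurable _)
    (Lp.aestronglyMeasurable _) hsum] with ω hω
  exact hω.limsup_eq

end MeasurableVersion

section ParabolicDistance

variable {d : ℕ}

lemma continuous_pdist : Continuous (fun q : SpaceTime d × SpaceTime d ↦ pdist q.1 q.2) := by
  unfold pdist
  fun_prop

lemma pdist_self (X : SpaceTime d) : pdist X X = 0 := by simp [pdist]

lemma pdist_nonneg (X Y : SpaceTime d) : 0 ≤ pdist X Y := le_max_of_le_left (norm_nonneg _)

lemma pdist_comm (X Y : SpaceTime d) : pdist X Y = pdist Y X := by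
  simp [pdist, norm_sub_rev, abs_sub_comm]

lemma abs_sub_le_pdist_sq (X Y : SpaceTime d) : |X.1 - Y.1| ≤ pdist X Y ^ 2 :=
  (Real.sqrt_le_left (pdist_nonneg X Y)).1 (le_max_right _ _)

lemma norm_sub_le_pdist (X Y : SpaceTime d) : ‖X.2 - Y.2‖ ≤ pdist X Y := le_max_left _ _

lemma pdist_triangle (X Y Z : SpaceTime d) : pdist X Z ≤ pdist X Y + pdist Y Z := by
  refine max_le ((norm_sub_le_norm_sub_add_norm_sub _ Y.2 _).trans
    (add_le_add (norm_sub_le_pdist X Y) (norm_sub_le_pdist Y Z))) (Real.sqrt_le_iff.2 ⟨?_, ?_⟩)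
  · exact add_nonneg (pdist_nonneg X Y) (pdist_nonneg Y Z)
  · have h := abs_sub_le X.1 Y.1 Z.1
    nlinarith [abs_sub_le_pdist_sq X Y, abs_sub_le_pdist_sq Y Z,
      mul_nonneg (pdist_nonneg X Y) (pdist_nonneg Y Z)]

lemma pdist_zero_le_one_add_norm (X : SpaceTime d) : pdist X 0 ≤ 1 + ‖X‖ := by
  have h₁ := norm_fst_le X
  have h₂ := norm_snd_le X
  rw [Real.norm_eq_abs] at h₁
  refine max_le ?_ (Real.sqrt_le_iff.2 ⟨by positivity, ?_⟩)
  · simpa only [Prod.snd_zero, sub_zero] using h₂.trans (le_add_of_nonneg_left zero_le_one)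
  · simp only [Prod.fst_zero, sub_zero]
    nlinarith [norm_nonneg X]

lemma pdist_zero_mono {r t : ℝ} (hr : 0 ≤ r) (hrt : r ≤ t) (x : EuclideanSpace ℝ (Fin d)) :
    pdist (r, x) 0 ≤ pdist (t, x) 0 := by
  simp only [pdist, Prod.fst_zero, Prod.snd_zero, sub_zero, abs_of_nonneg hr,
    abs_of_nonneg (hr.trans hrt)]
  gcongr

lemma ofReal_sub_rpow_half_le {γ : ℝ} (hγ : 0 ≤ γ) (X Y : SpaceTime d) :
    ENNReal.ofReal (X.1 - Y.1) ^ (γ / 2) ≤ ENNReal.ofReal (pdist X Y) ^ γ := by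
  calc ENNReal.ofReal (X.1 - Y.1) ^ (γ / 2)
      ≤ (ENNReal.ofReal (pdist X Y) ^ (2 : ℝ)) ^ (γ / 2) := by
        rw [ENNReal.rpow_ofNat, ← ENNReal.ofReal_pow (pdist_nonneg X Y)]
        gcongr
        exact (le_abs_self _).trans (abs_sub_le_pdist_sq X Y)
    _ = ENNReal.ofReal (pdist X Y) ^ γ := by rw [← ENNReal.rpow_mul, mul_div_cancel₀ _ two_ne_zero]

lemma tendsto_ofReal_pdist_rpow (X : SpaceTime d) {γ : ℝ} (hγ : 0 < γ) :
    Tendsto (fun Y ↦ ENNReal.ofReal (pdist Y X) ^ γ) (𝓝 X) (𝓝 0) := by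
  have hcont : Continuous fun Y : SpaceTime d ↦ pdist Y X := by
    unfold pdist
    fun_prop
  have h := (ENNReal.tendsto_ofReal (hcont.tendsto X)).ennrpow_const γ
  rwa [pdist_self, ENNReal.ofReal_zero, ENNReal.zero_rpow_of_pos hγ] at h

end ParabolicDistance

section HolderFunction

variable {d : ℕ} {C : ℝ≥0} {β : ℝ} {g : SpaceTime d → ℝ}

lemma IsPHolderWith.continuous_clamp (hg : IsPHolderWith C β g) (hβ : 0 < β) :
    Continuous (fun X : SpaceTime d ↦ g (max X.1 0, X.2)) := by
  refine continuous_iff_continuousAt.2 fun X ↦ tendsto_iff_norm_sub_tendsto_zero.2 ?_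
  have hc : Continuous fun Y : SpaceTime d ↦
      (C : ℝ) * pdist (max Y.1 0, Y.2) (max X.1 0, X.2) ^ β :=
    continuous_const.mul (Continuous.rpow_const (continuous_pdist.comp
      (f := fun Y : SpaceTime d ↦ (((max Y.1 0, Y.2) : SpaceTime d), (max X.1 0, X.2)))
      (by fun_prop)) fun _ ↦ Or.inr hβ.le)
  have hlim := hc.tendsto X
  rw [pdist_self, Real.zero_rpow hβ.ne', mul_zero] at hlim
  exact squeeze_zero (fun _ ↦ norm_nonneg _)
    (fun Y ↦ hg _ _ (le_max_right _ _) (le_max_right _ _)) hlim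

lemma IsPHolderWith.continuous_slice (hg : IsPHolderWith C β g) (hβ : 0 < β) {r : ℝ} (hr : 0 ≤ r)
    (x : EuclideanSpace ℝ (Fin d)) : Continuous (fun z ↦ g (r, x - z)) := by
  have h := (hg.continuous_clamp hβ).comp
    (f := fun z : EuclideanSpace ℝ (Fin d) ↦ ((r, x - z) : SpaceTime d)) (by fun_prop)
  simpa only [Function.comp_def, max_eq_left hr] using h

lemma IsPHolderWith.abs_le (hg : IsPHolderWith C β g) (hg0 : g (0, 0) = 0) (hβ : 0 ≤ β)
    (hβ' : β ≤ 1) {M : ℝ≥0} {r : ℝ} (hr : 0 ≤ r) {x : EuclideanSpace ℝ (Fin d)}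
    (hx : pdist (r, x) 0 ≤ M) (z : EuclideanSpace ℝ (Fin d)) :
    |g (r, x - z)| ≤ C * (1 + M ^ β) * (1 + ‖z‖ ^ β) := by
  have hδ : pdist (r, x - z) 0 ≤ M + ‖z‖ := by
    have hz : pdist (r, x - z) (r, x) = ‖z‖ := by simp [pdist]
    linarith [pdist_triangle (r, x - z) (r, x) 0]
  have hM : 0 ≤ (M : ℝ) ^ β := by positivity
  have hz : 0 ≤ ‖z‖ ^ β := by positivity
  calc |g (r, x - z)| ≤ C * pdist (r, x - z) 0 ^ β := by
        have h := hg (r, x - z) (0, 0) hr le_rfl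
        rwa [hg0, sub_zero] at h
    _ ≤ C * (M + ‖z‖) ^ β := by
        gcongr
        exact pdist_nonneg _ _
    _ ≤ C * (M ^ β + ‖z‖ ^ β) := by
        gcongr
        exact Real.rpow_add_le_add_rpow M.2 (norm_nonneg z) hβ hβ'
    _ ≤ C * ((1 + M ^ β) * (1 + ‖z‖ ^ β)) := by
        gcongr
        nlinarith [mul_nonneg hM hz]
    _ = C * (1 + M ^ β) * (1 + ‖z‖ ^ β) := (mul_assoc _ _ _).symm

lemma IsPHolderWith.enorm_le (hg : IsPHolderWith C β g) (hg0 : g (0, 0) = 0) (hβ : 0 ≤ β)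
    (hβ' : β ≤ 1) {M : ℝ≥0} {r : ℝ} (hr : 0 ≤ r) {x : EuclideanSpace ℝ (Fin d)}
    (hx : pdist (r, x) 0 ≤ M) (z : EuclideanSpace ℝ (Fin d)) :
    ‖g (r, x - z)‖ₑ ≤ (C * (1 + M ^ β) : ℝ≥0) * ENNReal.ofReal (1 + ‖z‖ ^ β) := by
  rw [Real.enorm_eq_ofReal_abs, ← ENNReal.ofReal_coe_nnreal,
    ← ENNReal.ofReal_mul (NNReal.coe_nonneg _)]
  exact ENNReal.ofReal_le_ofReal (by simpa using hg.abs_le hg0 hβ hβ' hr hx z)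

lemma IsPHolderWith.enorm_sub_le (hg : IsPHolderWith C β g) {r : ℝ} (hr : 0 ≤ r)
    (x y z : EuclideanSpace ℝ (Fin d)) :
    ‖g (r, x - z) - g (r, y - z)‖ₑ ≤ (C * ‖x - y‖₊ ^ β : ℝ≥0) := by
  rw [Real.enorm_eq_ofReal_abs, ← ENNReal.ofReal_coe_nnreal]
  exact ENNReal.ofReal_le_ofReal ((hg _ _ hr hr).trans_eq (by simp [pdist]))

end HolderFunction

section InnerConvolution

variable {d : ℕ} {β γ₁ γ₂ : ℝ} {T : ℝ≥0∞} {C N₀ N₁ N₂ : ℝ≥0} {K g : SpaceTime d → ℝ}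

/-- The weighted mass `∫ |F(z)| (1 + |z|^β) dz`, in which the hypotheses on the kernel are
phrased. -/
noncomputable def weightedMass (β : ℝ) (F : EuclideanSpace ℝ (Fin d) → ℝ) : ℝ≥0∞ :=
  ∫⁻ z, ‖F z‖ₑ * ENNReal.ofReal (1 + ‖z‖ ^ β)

/-- The inner integral `∫ K(t - r, y) g(r, x - y) dy` at `X = (t, x)`, as a function of `r`; the
stochastic convolution at `X` is its Wiener integral over `(0, t)`. -/
noncomputable def innerConv (K g : SpaceTime d → ℝ) (X : SpaceTime d) (r : ℝ) : ℝ :=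
  ∫ y, K (X.1 - r, y) * g (r, X.2 - y)

lemma measurable_weightedMass (hβ : 0 ≤ β) {F : ℝ → EuclideanSpace ℝ (Fin d) → ℝ}
    (hF : Measurable (fun q : ℝ × EuclideanSpace ℝ (Fin d) ↦ F q.1 q.2)) :
    Measurable (fun r ↦ weightedMass β (F r)) := by
  refine Measurable.lintegral_prod_right' (f := fun q : ℝ × EuclideanSpace ℝ (Fin d) ↦
    ‖F q.1 q.2‖ₑ * ENNReal.ofReal (1 + ‖q.2‖ ^ β)) (hF.enorm.mul (Continuous.measurable ?_))
  exact ENNReal.continuous_ofReal.comp (continuous_const.add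
    (continuous_snd.norm.rpow_const fun _ ↦ Or.inr hβ))

lemma measurable_kernel_reflect (hK : Measurable K) (t : ℝ) :
    Measurable (fun q : ℝ × EuclideanSpace ℝ (Fin d) ↦ K (t - q.1, q.2)) :=
  hK.comp (by fun_prop)

lemma stronglyMeasurable_innerConv_clamp (hK : Measurable K) (hg : IsPHolderWith C β g)
    (hβ : 0 < β) (X : SpaceTime d) :
    StronglyMeasurable (innerConv K (fun Y : SpaceTime d ↦ g (max Y.1 0, Y.2)) X) := by
  refine StronglyMeasurable.integral_prod_right' (f := fun q : ℝ × EuclideanSpace ℝ (Fin d) ↦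
    K (X.1 - q.1, q.2) * g (max q.1 0, X.2 - q.2)) (Measurable.stronglyMeasurable ?_)
  refine (measurable_kernel_reflect hK X.1).mul ?_
  exact (hg.continuous_clamp hβ).measurable.comp
    (f := fun q : ℝ × EuclideanSpace ℝ (Fin d) ↦ ((q.1, X.2 - q.2) : SpaceTime d)) (by fun_prop)

lemma aestronglyMeasurable_innerConv (hK : Measurable K) (hg : IsPHolderWith C β g)
    (hβ : 0 < β) (X : SpaceTime d) (t : ℝ) :
    AEStronglyMeasurable (innerConv K g X) (volume.restrict (Ioc 0 t)) := by
  refine (stronglyMeasurable_innerConv_clamp hK hg hβ X).aestronglyMeasurable.congr ?_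
  refine (ae_restrict_mem measurableSet_Ioc).mono fun r hr ↦ ?_
  simp only [innerConv, max_eq_left hr.1.le]

lemma lintegral_mul_enorm_le (hg : IsPHolderWith C β g) (hg0 : g (0, 0) = 0) (hβ : 0 ≤ β)
    (hβ' : β ≤ 1) {M : ℝ≥0} {r : ℝ} (hr : 0 ≤ r) {x : EuclideanSpace ℝ (Fin d)}
    (hx : pdist (r, x) 0 ≤ M) (F : EuclideanSpace ℝ (Fin d) → ℝ) :
    ∫⁻ z, ‖F z * g (r, x - z)‖ₑ ≤ (C * (1 + M ^ β) : ℝ≥0) * weightedMass β F := by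
  rw [weightedMass, ← lintegral_const_mul' _ _ ENNReal.coe_ne_top]
  refine lintegral_mono fun z ↦ ?_
  rw [enorm_mul, mul_left_comm]
  gcongr
  exact hg.enorm_le hg0 hβ hβ' hr hx z

lemma integrable_mul_of_weightedMass (hg : IsPHolderWith C β g) (hg0 : g (0, 0) = 0) (hβ : 0 < β)
    (hβ' : β ≤ 1) {r : ℝ} (hr : 0 ≤ r) (x : EuclideanSpace ℝ (Fin d))
    {F : EuclideanSpace ℝ (Fin d) → ℝ} (hF : Measurable F) (hFm : weightedMass β F < ∞) :
    Integrable (fun z ↦ F z * g (r, x - z)) := by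
  refine ⟨(hF.mul (hg.continuous_slice hβ hr x).measurable).aestronglyMeasurable, ?_⟩
  exact (lintegral_mul_enorm_le hg hg0 hβ.le hβ' hr (M := (pdist (r, x) 0).toNNReal)
    (Real.le_coe_toNNReal _) F).trans_lt (ENNReal.mul_lt_top ENNReal.coe_lt_top hFm)

lemma enorm_innerConv_le (hg : IsPHolderWith C β g) (hg0 : g (0, 0) = 0) (hβ : 0 ≤ β)
    (hβ' : β ≤ 1) {M : ℝ≥0} {X : SpaceTime d} (hX : pdist X 0 ≤ M) {r : ℝ}
    (hr : r ∈ Ioc 0 X.1) :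
    ‖innerConv K g X r‖ₑ ≤ (C * (1 + M ^ β) : ℝ≥0) * weightedMass β (fun z ↦ K (X.1 - r, z)) :=
  (enorm_integral_le_lintegral_enorm _).trans (lintegral_mul_enorm_le hg hg0 hβ hβ' hr.1.le
    ((pdist_zero_mono hr.1.le hr.2 X.2).trans hX) _)

lemma enorm_innerConv_sub_le (hK : Measurable K) (hg : IsPHolderWith C β g)
    (hg0 : g (0, 0) = 0) (hβ : 0 ≤ β) (hβ' : β ≤ 1) {M : ℝ≥0} {X Y : SpaceTime d}
    (hX : pdist X 0 ≤ M) {r : ℝ} (hr : r ∈ Ioc 0 X.1)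
    (hrX : Integrable fun y ↦ K (X.1 - r, y) * g (r, X.2 - y))
    (hrY : Integrable fun y ↦ K (Y.1 - r, y) * g (r, Y.2 - y)) :
    ‖innerConv K g X r - innerConv K g Y r‖ₑ ≤
      (C * (1 + M ^ β) : ℝ≥0) * weightedMass β (fun z ↦ K (X.1 - r, z) - K (Y.1 - r, z)) +
      (C * ‖X.2 - Y.2‖₊ ^ β : ℝ≥0) * ∫⁻ z, ‖K (Y.1 - r, z)‖ₑ := by
  rw [innerConv, innerConv, ← integral_sub hrX hrY]
  have hKm : Measurable fun z ↦ ‖K (Y.1 - r, z)‖ₑ := (hK.comp (by fun_prop)).enorm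
  have hsplit (z : EuclideanSpace ℝ (Fin d)) :
      K (X.1 - r, z) * g (r, X.2 - z) - K (Y.1 - r, z) * g (r, Y.2 - z) =
        (K (X.1 - r, z) - K (Y.1 - r, z)) * g (r, X.2 - z) +
        (g (r, X.2 - z) - g (r, Y.2 - z)) * K (Y.1 - r, z) := by ring
  calc _ ≤ ∫⁻ z, ‖K (X.1 - r, z) * g (r, X.2 - z) - K (Y.1 - r, z) * g (r, Y.2 - z)‖ₑ :=
        enorm_integral_le_lintegral_enorm _
    _ ≤ ∫⁻ z, (‖(K (X.1 - r, z) - K (Y.1 - r, z)) * g (r, X.2 - z)‖ₑ +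
        (C * ‖X.2 - Y.2‖₊ ^ β : ℝ≥0) * ‖K (Y.1 - r, z)‖ₑ) := by
        refine lintegral_mono fun z ↦ ?_
        rw [hsplit]
        refine (enorm_add_le _ _).trans ?_
        rw [enorm_mul (g (r, X.2 - z) - g (r, Y.2 - z))]
        gcongr
        exact hg.enorm_sub_le hr.1.le _ _ _
    _ = (∫⁻ z, ‖(K (X.1 - r, z) - K (Y.1 - r, z)) * g (r, X.2 - z)‖ₑ) +
        (C * ‖X.2 - Y.2‖₊ ^ β : ℝ≥0) * ∫⁻ z, ‖K (Y.1 - r, z)‖ₑ := by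
        rw [lintegral_add_right _ (hKm.const_mul _),
          lintegral_const_mul' _ _ ENNReal.coe_ne_top]
    _ ≤ _ := by
        gcongr
        exact lintegral_mul_enorm_le hg hg0 hβ hβ' hr.1.le
          ((pdist_zero_mono hr.1.le hr.2 X.2).trans hX) _

end InnerConvolution

section KernelBounds

variable {d : ℕ} {β γ₁ γ₂ : ℝ} {T : ℝ≥0∞} {C N₀ N₁ N₂ : ℝ≥0} {K g : SpaceTime d → ℝ}

lemma eLpNorm_two_le_of_lintegral_sq_le {α : Type*} [MeasurableSpace α] {μ : Measure α}
    {f : α → ℝ≥0∞} {N : ℝ≥0} {a : ℝ≥0∞} (γ : ℝ) (h : ∫⁻ x, f x ^ 2 ∂μ ≤ N * a ^ γ) :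
    eLpNorm f 2 μ ≤ NNReal.sqrt N * a ^ (γ / 2) := by
  rw [eLpNorm_eq_lintegral_rpow_enorm_toReal two_ne_zero ENNReal.ofNat_ne_top]
  simp only [ENNReal.toReal_ofNat, ENNReal.rpow_ofNat, enorm_eq_self]
  calc (∫⁻ x, f x ^ 2 ∂μ) ^ (1 / 2 : ℝ) ≤ (N * a ^ γ) ^ (1 / 2 : ℝ) := by gcongr
    _ = NNReal.sqrt N * a ^ (γ / 2) := by
      rw [ENNReal.mul_rpow_of_nonneg _ _ (by norm_num), ← ENNReal.rpow_mul, NNReal.sqrt_eq_rpow,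
        ENNReal.coe_rpow_of_nonneg _ (by norm_num), mul_one_div]

lemma KernelBounds.eLpNorm_tail_le (hB : KernelBounds T β γ₁ γ₂ N₀ N₁ N₂ K) {s t : ℝ}
    (hs : 0 ≤ s) (hst : s ≤ t) (ht : ENNReal.ofReal t ≤ T) :
    eLpNorm (fun r ↦ weightedMass β (fun z ↦ K (t - r, z))) 2 (volume.restrict (Ioc s t)) ≤
      NNReal.sqrt N₂ * ENNReal.ofReal (t - s) ^ (γ₂ / 2) := by
  rcases hst.eq_or_lt with rfl | hst
  · simp
  refine eLpNorm_two_le_of_lintegral_sq_le γ₂ ?_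
  rw [← restrict_Ioo_eq_restrict_Ioc, ENNReal.ofReal_rpow_of_pos (sub_pos.2 hst)]
  exact hB.tail s t hs hst ht

lemma KernelBounds.eLpNorm_increment_le (hB : KernelBounds T β γ₁ γ₂ N₀ N₁ N₂ K) {s t : ℝ}
    (hs : 0 ≤ s) (hst : s ≤ t) (ht : ENNReal.ofReal t ≤ T) :
    eLpNorm (fun r ↦ weightedMass β (fun z ↦ K (t - r, z) - K (s - r, z))) 2
      (volume.restrict (Ioc 0 s)) ≤ NNReal.sqrt N₁ * ENNReal.ofReal (t - s) ^ (γ₁ / 2) := by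
  rcases hst.eq_or_lt with rfl | hst
  · simp [weightedMass]
  refine eLpNorm_two_le_of_lintegral_sq_le γ₁ ?_
  rw [← restrict_Ioo_eq_restrict_Ioc, ENNReal.ofReal_rpow_of_pos (sub_pos.2 hst)]
  exact hB.increment s t hs hst ht

lemma KernelBounds.eLpNorm_mass_le (hB : KernelBounds T β γ₁ γ₂ N₀ N₁ N₂ K) {s : ℝ}
    (hs : 0 ≤ s) (hsT : ENNReal.ofReal s < T) :
    eLpNorm (fun r ↦ ∫⁻ z, ‖K (s - r, z)‖ₑ) 2 (volume.restrict (Ioc 0 s)) ≤ NNReal.sqrt N₀ := by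
  obtain ⟨t, hst, htT⟩ := exists_between hsT
  have h := hB.bound s t.toReal hs ((ENNReal.ofReal_lt_iff_lt_toReal hs htT.ne_top).1 hst)
    ((ENNReal.ofReal_toReal htT.ne_top).trans_le htT.le)
  rw [restrict_Ioo_eq_restrict_Ioc] at h
  simpa using eLpNorm_two_le_of_lintegral_sq_le (a := 1) 0 (by simpa using h)

lemma KernelBounds.ae_weightedMass_lt_top (hK : Measurable K) (hβ : 0 ≤ β)
    (hB : KernelBounds T β γ₁ γ₂ N₀ N₁ N₂ K) {t : ℝ} (ht0 : 0 < t) (ht : ENNReal.ofReal t ≤ T) :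
    ∀ᵐ r ∂volume.restrict (Ioc 0 t), weightedMass β (fun z ↦ K (t - r, z)) < ∞ := by
  have hfin := (hB.tail 0 t le_rfl ht0 ht).trans_lt
    (ENNReal.mul_lt_top ENNReal.coe_lt_top ENNReal.ofReal_lt_top)
  rw [restrict_Ioo_eq_restrict_Ioc] at hfin
  filter_upwards [ae_lt_top ((measurable_weightedMass hβ
    (measurable_kernel_reflect hK t)).pow_const 2) hfin.ne] with r hr
  simpa using hr

lemma KernelBounds.ae_integrable_innerConv (hK : Measurable K) (hβ : 0 < β) (hβ' : β ≤ 1)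
    (hB : KernelBounds T β γ₁ γ₂ N₀ N₁ N₂ K) (hg : IsPHolderWith C β g) (hg0 : g (0, 0) = 0)
    {X : SpaceTime d} (hX : X ∈ timeStrip d T) :
    ∀ᵐ r ∂volume.restrict (Ioc 0 X.1), Integrable (fun y ↦ K (X.1 - r, y) * g (r, X.2 - y)) := by
  filter_upwards [hB.ae_weightedMass_lt_top hK hβ.le hX.1 hX.2.le,
    ae_restrict_mem measurableSet_Ioc] with r hr hr'
  exact integrable_mul_of_weightedMass hg hg0 hβ hβ' hr'.1.le X.2 (hK.comp (by fun_prop)) hr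

end KernelBounds

section HolderIntegrand

variable {d : ℕ} {β γ₁ γ₂ : ℝ} {T : ℝ≥0∞} {C N₀ N₁ N₂ M : ℝ≥0} {K g : SpaceTime d → ℝ}
  {X Y : SpaceTime d}

lemma eLpNorm_sub_indicator_Ioc_le {s t : ℝ} {p : ℝ≥0∞} (hp : 1 ≤ p) {f g : ℝ → ℝ}
    (hf : AEStronglyMeasurable f (volume.restrict (Ioc 0 t)))
    (hg : AEStronglyMeasurable g (volume.restrict (Ioc 0 s))) (hst : s ≤ t) :
    eLpNorm (f - (Ioc 0 s).indicator g) p (volume.restrict (Ioc 0 t)) ≤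
      eLpNorm (f - g) p (volume.restrict (Ioc 0 s)) + eLpNorm f p (volume.restrict (Ioc s t)) := by
  have hsplit : f - (Ioc 0 s).indicator g =ᵐ[volume.restrict (Ioc 0 t)]
      (Ioc 0 s).indicator (f - g) + (Ioc s t).indicator f := by
    refine (ae_restrict_mem measurableSet_Ioc).mono fun r hr ↦ ?_
    simp only [Pi.sub_apply, Pi.add_apply, indicator_apply, mem_Ioc, hr.1, hr.2, true_and, and_true]
    rcases le_or_gt r s with h | h
    · simp [h, h.not_gt]
    · simp [h, h.not_ge]
  have hfg : AEStronglyMeasurable ((Ioc 0 s).indicator (f - g)) (volume.restrict (Ioc 0 t)) := by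
    rw [aestronglyMeasurable_indicator_iff measurableSet_Ioc,
      Measure.restrict_restrict_of_subset (Ioc_subset_Ioc_right hst)]
    exact (hf.mono_measure (Measure.restrict_mono (Ioc_subset_Ioc_right hst) le_rfl)).sub hg
  rw [eLpNorm_congr_ae hsplit]
  refine (eLpNorm_add_le hfg (hf.indicator measurableSet_Ioc) hp).trans
    (add_le_add (eLpNorm_indicator_Ioc hst _ p).le ?_)
  rw [eLpNorm_indicator_eq_eLpNorm_restrict measurableSet_Ioc,
    Measure.restrict_restrict measurableSet_Ioc]
  exact eLpNorm_mono_measure _ (Measure.restrict_mono inter_subset_left le_rfl)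

lemma eLpNorm_innerConv_tail_le (hB : KernelBounds T β γ₁ γ₂ N₀ N₁ N₂ K)
    (hg : IsPHolderWith C β g) (hg0 : g (0, 0) = 0) (hβ : 0 ≤ β) (hβ' : β ≤ 1)
    (hX : X ∈ timeStrip d T) (hXM : pdist X 0 ≤ M) {s : ℝ} (hs : 0 ≤ s) (hsX : s ≤ X.1) :
    eLpNorm (innerConv K g X) 2 (volume.restrict (Ioc s X.1)) ≤
      (C * (1 + M ^ β) : ℝ≥0) * (NNReal.sqrt N₂ * ENNReal.ofReal (X.1 - s) ^ (γ₂ / 2)) := by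
  refine (eLpNorm_le_mul_eLpNorm_of_ae_le_mul' ?_ 2).trans
    (mul_le_mul_right (hB.eLpNorm_tail_le hs hsX hX.2.le) _)
  filter_upwards [ae_restrict_mem measurableSet_Ioc] with r hr
  exact enorm_innerConv_le hg hg0 hβ hβ' hXM (Ioc_subset_Ioc_left hs hr)

lemma memLp_innerConv (hK : Measurable K) (hB : KernelBounds T β γ₁ γ₂ N₀ N₁ N₂ K)
    (hg : IsPHolderWith C β g) (hg0 : g (0, 0) = 0) (hβ : 0 < β) (hβ' : β ≤ 1)
    (hγ₂ : 0 ≤ γ₂) (hX : X ∈ timeStrip d T) :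
    MemLp (innerConv K g X) 2 (volume.restrict (Ioc 0 X.1)) := by
  refine ⟨aestronglyMeasurable_innerConv hK hg hβ X X.1, (eLpNorm_innerConv_tail_le hB hg hg0 hβ.le
    hβ' hX (Real.le_coe_toNNReal _) le_rfl hX.1.le).trans_lt ?_⟩
  exact ENNReal.mul_lt_top ENNReal.coe_lt_top (ENNReal.mul_lt_top ENNReal.coe_lt_top
    (ENNReal.rpow_lt_top_of_nonneg (by positivity) ENNReal.ofReal_ne_top))

lemma eLpNorm_innerConv_sub_le (hK : Measurable K) (hB : KernelBounds T β γ₁ γ₂ N₀ N₁ N₂ K)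
    (hg : IsPHolderWith C β g) (hg0 : g (0, 0) = 0) (hβ : 0 < β) (hβ' : β ≤ 1)
    (hX : X ∈ timeStrip d T) (hY : Y ∈ timeStrip d T) (hXM : pdist X 0 ≤ M) (hYX : Y.1 ≤ X.1) :
    eLpNorm (innerConv K g X - innerConv K g Y) 2 (volume.restrict (Ioc 0 Y.1)) ≤
      (C * (1 + M ^ β) : ℝ≥0) * (NNReal.sqrt N₁ * ENNReal.ofReal (X.1 - Y.1) ^ (γ₁ / 2)) +
        (C * ‖X.2 - Y.2‖₊ ^ β : ℝ≥0) * NNReal.sqrt N₀ := by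
  set a : ℝ≥0 := C * (1 + M ^ β)
  set b : ℝ≥0 := C * ‖X.2 - Y.2‖₊ ^ β
  set w := fun r ↦ weightedMass β (fun z ↦ K (X.1 - r, z) - K (Y.1 - r, z))
  set m := fun r ↦ ∫⁻ z, ‖K (Y.1 - r, z)‖ₑ
  have hw : Measurable w := measurable_weightedMass hβ.le
    ((measurable_kernel_reflect hK X.1).sub (measurable_kernel_reflect hK Y.1))
  have hm : Measurable m := (measurable_kernel_reflect hK Y.1).enorm.lintegral_prod_right'
  have hle : ∀ᵐ r ∂volume.restrict (Ioc 0 Y.1),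
      ‖(innerConv K g X - innerConv K g Y) r‖ₑ ≤ ‖(a • w + b • m) r‖ₑ := by
    filter_upwards [hB.ae_integrable_innerConv hK hβ hβ' hg hg0 hY,
      ae_mono (Measure.restrict_mono (Ioc_subset_Ioc_right hYX) le_rfl)
        (hB.ae_integrable_innerConv hK hβ hβ' hg hg0 hX),
      ae_restrict_mem measurableSet_Ioc] with r hrY hrX hr
    exact enorm_innerConv_sub_le hK hg hg0 hβ.le hβ' hXM (Ioc_subset_Ioc_right hYX hr) hrX hrY
  have hmul (c : ℝ≥0) (f : ℝ → ℝ≥0∞) :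
      eLpNorm (c • f) 2 (volume.restrict (Ioc 0 Y.1)) ≤
        c * eLpNorm f 2 (volume.restrict (Ioc 0 Y.1)) :=
    eLpNorm_le_mul_eLpNorm_of_ae_le_mul' (Eventually.of_forall fun r ↦ le_rfl) 2
  calc _ ≤ eLpNorm (a • w + b • m) 2 (volume.restrict (Ioc 0 Y.1)) :=
        eLpNorm_mono_enorm_ae hle
    _ ≤ eLpNorm (a • w) 2 (volume.restrict (Ioc 0 Y.1)) +
          eLpNorm (b • m) 2 (volume.restrict (Ioc 0 Y.1)) :=
        eLpNorm_add_le (hw.const_smul a).aestronglyMeasurable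
          (hm.const_smul b).aestronglyMeasurable one_le_two
    _ ≤ _ := add_le_add
        ((hmul a w).trans (mul_le_mul_right (hB.eLpNorm_increment_le hY.1.le hYX hX.2.le) _))
        ((hmul b m).trans (mul_le_mul_right (hB.eLpNorm_mass_le hY.1.le hY.2) _))

lemma rpow_le_rpow_sub_mul_rpow {δ L : ℝ≥0∞} (hδ : δ ≤ L) {a γ : ℝ} (hγ : 0 ≤ γ) (hγa : γ ≤ a) :
    δ ^ a ≤ L ^ (a - γ) * δ ^ γ := by
  calc δ ^ a = δ ^ (a - γ) * δ ^ γ := by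
        rw [← ENNReal.rpow_add_of_nonneg _ _ (sub_nonneg.2 hγa) hγ, sub_add_cancel]
    _ ≤ L ^ (a - γ) * δ ^ γ := by gcongr

/-- The Hölder constant, with respect to the parabolic distance, of the integrand of the
stochastic convolution as a map from `{X : δ(X, 0) ≤ M}` to `L²`. -/
noncomputable def holderConst (β γ₁ γ₂ : ℝ) (N₀ N₁ N₂ C M : ℝ≥0) : ℝ≥0 :=
  C * (1 + M ^ β) * (NNReal.sqrt N₁ * (2 * M) ^ (γ₁ - min (min γ₁ γ₂) β) +
    NNReal.sqrt N₂ * (2 * M) ^ (γ₂ - min (min γ₁ γ₂) β)) +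
  C * NNReal.sqrt N₀ * (2 * M) ^ (β - min (min γ₁ γ₂) β)

lemma sum_rpow_le_holderConst_mul (hβ : 0 ≤ β) (hγ₁ : 0 ≤ γ₁) (hγ₂ : 0 ≤ γ₂) {δ : ℝ≥0∞}
    (hδ : δ ≤ (2 * M : ℝ≥0)) :
    (C * (1 + M ^ β) : ℝ≥0) * (NNReal.sqrt N₁ * δ ^ γ₁) + C * δ ^ β * NNReal.sqrt N₀ +
        (C * (1 + M ^ β) : ℝ≥0) * (NNReal.sqrt N₂ * δ ^ γ₂) ≤
      holderConst β γ₁ γ₂ N₀ N₁ N₂ C M * δ ^ min (min γ₁ γ₂) β := by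
  rw [holderConst]
  set γ := min (min γ₁ γ₂) β
  have hγ0 : 0 ≤ γ := le_min (le_min hγ₁ hγ₂) hβ
  have hrpow {a : ℝ} (ha : γ ≤ a) : δ ^ a ≤ ((2 * M) ^ (a - γ) : ℝ≥0) * δ ^ γ := by
    rw [ENNReal.coe_rpow_of_nonneg _ (sub_nonneg.2 ha)]
    exact rpow_le_rpow_sub_mul_rpow hδ hγ0 ha
  set a : ℝ≥0 := C * (1 + M ^ β)
  calc _ ≤ a * (NNReal.sqrt N₁ * (((2 * M) ^ (γ₁ - γ) : ℝ≥0) * δ ^ γ)) +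
        C * (((2 * M) ^ (β - γ) : ℝ≥0) * δ ^ γ) * NNReal.sqrt N₀ +
        a * (NNReal.sqrt N₂ * (((2 * M) ^ (γ₂ - γ) : ℝ≥0) * δ ^ γ)) := by
        gcongr
        · exact hrpow ((min_le_left _ _).trans (min_le_left _ _))
        · exact hrpow (min_le_right _ _)
        · exact hrpow ((min_le_left _ _).trans (min_le_right _ _))
    _ = _ := by
        simp only [ENNReal.coe_add, ENNReal.coe_mul]
        ring

lemma eLpNorm_innerConv_sub_indicator_le (hK : Measurable K)
    (hB : KernelBounds T β γ₁ γ₂ N₀ N₁ N₂ K) (hg : IsPHolderWith C β g) (hg0 : g (0, 0) = 0)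
    (hβ : 0 < β) (hβ' : β ≤ 1) (hγ₁ : 0 ≤ γ₁) (hγ₂ : 0 ≤ γ₂) (hX : X ∈ timeStrip d T)
    (hY : Y ∈ timeStrip d T) (hXM : pdist X 0 ≤ M) (hYM : pdist Y 0 ≤ M) (hYX : Y.1 ≤ X.1) :
    eLpNorm (innerConv K g X - (Ioc 0 Y.1).indicator (innerConv K g Y)) 2
        (volume.restrict (Ioc 0 X.1)) ≤
      holderConst β γ₁ γ₂ N₀ N₁ N₂ C M * ENNReal.ofReal (pdist X Y) ^ min (min γ₁ γ₂) β := by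
  have hδ : ENNReal.ofReal (pdist X Y) ≤ (2 * M : ℝ≥0) := by
    rw [← ENNReal.ofReal_coe_nnreal]
    refine ENNReal.ofReal_le_ofReal ((pdist_triangle X 0 Y).trans ?_)
    rw [pdist_comm 0 Y, NNReal.coe_mul, NNReal.coe_ofNat]
    linarith
  have hspace : ((‖X.2 - Y.2‖₊ ^ β : ℝ≥0) : ℝ≥0∞) ≤ ENNReal.ofReal (pdist X Y) ^ β := by
    rw [ENNReal.coe_rpow_of_nonneg _ hβ.le, ← enorm_eq_nnnorm, ← ofReal_norm]
    gcongr
    exact norm_sub_le_pdist X Y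
  refine (eLpNorm_sub_indicator_Ioc_le one_le_two (aestronglyMeasurable_innerConv hK hg hβ X X.1)
    (aestronglyMeasurable_innerConv hK hg hβ Y Y.1) hYX).trans ?_
  refine le_trans (add_le_add
    (eLpNorm_innerConv_sub_le hK hB hg hg0 hβ hβ' hX hY hXM hYX)
    (eLpNorm_innerConv_tail_le hB hg hg0 hβ.le hβ' hX hXM hY.1.le hYX))
    (le_trans ?_ (sum_rpow_le_holderConst_mul hβ.le hγ₁ hγ₂ hδ))
  rw [ENNReal.coe_mul C (_ ^ β)]
  gcongr
  · exact ofReal_sub_rpow_half_le hγ₁ X Y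
  · exact ofReal_sub_rpow_half_le hγ₂ X Y

end HolderIntegrand

section MomentBound

variable {d : ℕ} {β γ₁ γ₂ : ℝ} {T : ℝ≥0∞} {C N₀ N₁ N₂ M : ℝ≥0} {K g : SpaceTime d → ℝ}
  {X Y : SpaceTime d} {Ω : Type*} [MeasurableSpace Ω] {P : Measure Ω} {W : ℝ≥0 → Ω → ℝ}
  {ξ η : Ω → ℝ}

lemma IsWienerIntegral.eLpNorm_sub_le [IsProbabilityMeasure P] (hW : IsWienerProcess T W P)
    (hK : Measurable K) (hB : KernelBounds T β γ₁ γ₂ N₀ N₁ N₂ K) (hg : IsPHolderWith C β g)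
    (hg0 : g (0, 0) = 0) (hβ : 0 < β) (hβ' : β ≤ 1) (hγ₁ : 0 ≤ γ₁) (hγ₂ : 0 ≤ γ₂)
    (hX : X ∈ timeStrip d T) (hY : Y ∈ timeStrip d T) (hXM : pdist X 0 ≤ M) (hYM : pdist Y 0 ≤ M)
    (hξ : IsWienerIntegral W P X.1 (innerConv K g X) ξ)
    (hη : IsWienerIntegral W P Y.1 (innerConv K g Y) η) (q : ℝ≥0∞) :
    eLpNorm (ξ - η) q P ≤ eLpNorm id q (gaussianReal 0 1) *
      (holderConst β γ₁ γ₂ N₀ N₁ N₂ C M * ENNReal.ofReal (pdist X Y) ^ min (min γ₁ γ₂) β) := by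
  wlog hYX : Y.1 ≤ X.1 generalizing X Y ξ η
  · rw [eLpNorm_sub_comm, pdist_comm]
    exact this hY hX hYM hXM hη hξ (le_of_not_ge hYX)
  rw [(hξ.sub hW hX.2.le (hη.indicator hYX)).eLpNorm_eq hW hX.2.le]
  gcongr
  exact eLpNorm_innerConv_sub_indicator_le hK hB hg hg0 hβ hβ' hγ₁ hγ₂ hX hY hXM hYM hYX

end MomentBound

section ParabolicBall

lemma nontrivial_of_isOpen {E : Type*} [TopologicalSpace E] [T1Space E] [PerfectSpace E]
    {s : Set E} (hs : IsOpen s) (hne : s.Nonempty) : s.Nontrivial := by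
  obtain ⟨x, hx⟩ := hne
  exact (infinite_of_mem_nhds x (hs.mem_nhds hx)).nontrivial

variable {d : ℕ} {D : Set (SpaceTime d)} {X Y : SpaceTime d}

lemma pdist_pos (h : X ≠ Y) : 0 < pdist X Y := by
  refine (pdist_nonneg X Y).lt_of_ne' fun h0 ↦ h (Prod.ext ?_ ?_)
  · have := abs_sub_le_pdist_sq X Y
    exact sub_eq_zero.1 (abs_nonpos_iff.1 (by simpa [h0] using this))
  · exact sub_eq_zero.1 (norm_le_zero_iff.1 (h0 ▸ norm_sub_le_pdist X Y))

lemma pball_eq_prod (X : SpaceTime d) {c : ℝ} (hc : 0 < c) :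
    pball X c = Metric.ball X.1 (c ^ 2) ×ˢ Metric.ball X.2 c := by
  ext Y
  simp only [pball, pdist, mem_ofPred_eq, max_lt_iff, mem_prod, Metric.mem_ball, dist_comm Y.1,
    dist_comm Y.2, dist_eq_norm, Real.sqrt_lt' hc]
  exact and_comm

lemma measurableSet_pball (X : SpaceTime d) (c : ℝ) : MeasurableSet (pball X c) :=
  measurableSet_lt (continuous_pdist.comp (Continuous.prodMk_right X)).measurable measurable_const

variable (d) in
/-- The Lebesgue measure of the unit parabolic ball in `ℝ × ℝ^d`, which is the product of the
interval `(-1, 1)` with the Euclidean unit ball. -/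
noncomputable def unitPballVolume : ℝ≥0∞ :=
  2 * volume (Metric.ball (0 : EuclideanSpace ℝ (Fin d)) 1)

lemma unitPballVolume_ne_zero : unitPballVolume d ≠ 0 :=
  mul_ne_zero two_ne_zero (Metric.measure_ball_pos _ _ one_pos).ne'

lemma unitPballVolume_ne_top : unitPballVolume d ≠ ∞ :=
  ENNReal.mul_ne_top ENNReal.ofNat_ne_top measure_ball_lt_top.ne

lemma volume_pball (X : SpaceTime d) {c : ℝ} (hc : 0 < c) :
    volume (pball X c) = ENNReal.ofReal c ^ (d + 2) * unitPballVolume d := by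
  rw [pball_eq_prod X hc, Measure.volume_eq_prod, Measure.prod_prod, Real.volume_ball,
    Measure.addHaar_ball_of_pos _ _ hc, finrank_euclideanSpace, Fintype.card_fin,
    ENNReal.ofReal_mul two_pos.le, ENNReal.ofReal_ofNat, ENNReal.ofReal_pow hc.le,
    ENNReal.ofReal_pow hc.le, unitPballVolume]
  ring

lemma pdist_le_pdiam (hX : X ∈ D) (hY : Y ∈ D) : ENNReal.ofReal (pdist X Y) ≤ pdiam D :=
  le_iSup₂_of_le X hX (le_iSup₂_of_le Y hY le_rfl)

lemma pdiam_pos (hD : D.Nontrivial) : 0 < pdiam D := by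
  obtain ⟨X, hX, Y, hY, hXY⟩ := hD
  exact (ENNReal.ofReal_pos.2 (pdist_pos hXY)).trans_le (pdist_le_pdiam hX hY)

lemma IsATypeWith.exists_radius {A : ℝ≥0} (hA : IsATypeWith A D) (hD : D.Nontrivial)
    (hX : X ∈ D) {c : ℝ} (hc : 0 < c) :
    ∃ ρ : ℝ, 0 < ρ ∧ A * volume (pball X ρ) ≤ volume (D ∩ pball X c) ∧
      ∀ Y ∈ D ∩ pball X c, ∀ Z ∈ D ∩ pball X c, pdist Y Z ≤ 2 * ρ := by
  rcases le_or_gt (ENNReal.ofReal c) (pdiam D) with hcD | hcD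
  · refine ⟨c, hc, hA.2 X hX c hc hcD, fun Y hY Z hZ ↦ (pdist_triangle Y X Z).trans ?_⟩
    rw [pdist_comm Y X, two_mul]
    exact add_le_add hY.2.le hZ.2.le
  · have htop : pdiam D ≠ ∞ := hcD.ne_top
    have hρ : 0 < (pdiam D).toReal := ENNReal.toReal_pos (pdiam_pos hD).ne' htop
    have hρc : (pdiam D).toReal ≤ c := ENNReal.toReal_le_of_le_ofReal hc.le hcD.le
    refine ⟨(pdiam D).toReal, hρ, ?_, fun Y hY Z hZ ↦ ?_⟩
    · refine (hA.2 X hX _ hρ (ENNReal.ofReal_toReal htop).le).trans ?_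
      exact measure_mono (inter_subset_inter_right _ fun _ hY ↦ lt_of_lt_of_le hY hρc)
    · have := (ENNReal.ofReal_le_iff_le_toReal htop).1 (pdist_le_pdiam hY.1 hZ.1)
      linarith

end ParabolicBall

section Campanato

variable {d : ℕ} {Ω : Type*} [MeasurableSpace Ω] {P : Measure Ω} {A : ℝ≥0}
  {D : Set (SpaceTime d)} {p γ : ℝ} {u : SpaceTime d → Ω → ℝ} {C : ℝ≥0∞}

lemma lintegral_rpow_enorm_sub_le [SFinite P] (hu : Measurable fun q : SpaceTime d × Ω ↦ u q.1 q.2)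
    {Q : Set (SpaceTime d)} (hQ : MeasurableSet Q)
    (hC : ∀ Y ∈ Q, ∀ Z ∈ Q, ∫⁻ ω, ‖u Y ω - u Z ω‖ₑ ^ p ∂P ≤ C) :
    ∫⁻ ω, (∫⁻ Y in Q, ∫⁻ Z in Q, ‖u Y ω - u Z ω‖ₑ ^ p) ∂P ≤ C * volume Q ^ 2 := by
  have hm : Measurable fun q : (Ω × SpaceTime d) × SpaceTime d ↦
      ‖u q.1.2 q.1.1 - u q.2 q.1.1‖ₑ ^ p := by
    refine ((Measurable.sub ?_ ?_).enorm).pow_const p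
    · exact hu.comp (f := fun q : (Ω × SpaceTime d) × SpaceTime d ↦ (q.1.2, q.1.1)) (by fun_prop)
    · exact hu.comp (f := fun q : (Ω × SpaceTime d) × SpaceTime d ↦ (q.2, q.1.1)) (by fun_prop)
  rw [lintegral_lintegral_swap hm.lintegral_prod_right'.aemeasurable]
  calc _ = ∫⁻ Y in Q, ∫⁻ Z in Q, ∫⁻ ω, ‖u Y ω - u Z ω‖ₑ ^ p ∂P :=
        lintegral_congr fun Y ↦ lintegral_lintegral_swap (hm.comp
          (f := fun q : Ω × SpaceTime d ↦ ((q.1, Y), q.2)) (by fun_prop)).aemeasurable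
    _ ≤ ∫⁻ _ in Q, ∫⁻ _ in Q, C :=
        setLIntegral_mono' hQ fun _ hY ↦ setLIntegral_mono' hQ fun _ hZ ↦ hC _ hY _ hZ
    _ = C * volume Q ^ 2 := by
        simp [sq, mul_assoc]

/-- The bound on the Campanato seminorm, over an `A`-type set, of a random field `u` with
`𝔼 |u(Y) - u(Z)|^p ≤ C δ(Y, Z)^(γ p)`. -/
noncomputable def campanatoConst (d : ℕ) (p γ : ℝ) (A : ℝ≥0) (C : ℝ≥0∞) : ℝ≥0∞ :=
  (C * 2 ^ (γ * p) * (A * unitPballVolume d)⁻¹ ^ (γ * p / ((d : ℝ) + 2))) ^ (1 / p)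

lemma campanatoConst_ne_top (hp : 0 ≤ p) (hγ : 0 ≤ γ) (hA : A ≠ 0) (hC : C ≠ ∞) :
    campanatoConst d p γ A C ≠ ∞ := by
  have hinv : (A * unitPballVolume d)⁻¹ ≠ ∞ :=
    ENNReal.inv_ne_top.2 (mul_ne_zero (ENNReal.coe_ne_zero.2 hA) unitPballVolume_ne_zero)
  refine ENNReal.rpow_ne_top_of_nonneg (by positivity) (ENNReal.mul_ne_top (ENNReal.mul_ne_top hC
    (ENNReal.rpow_ne_top_of_nonneg (by positivity) ENNReal.ofNat_ne_top))
    (ENNReal.rpow_ne_top_of_nonneg (by positivity) hinv))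

lemma rpow_radius_le {X : SpaceTime d} {Q : Set (SpaceTime d)} (hA : A ≠ 0) {a ρ : ℝ}
    (ha : 0 ≤ a) (hρ : 0 < ρ) (hQ : A * volume (pball X ρ) ≤ volume Q) :
    ENNReal.ofReal ρ ^ a ≤ (A * unitPballVolume d)⁻¹ ^ (a / ((d : ℝ) + 2)) *
      volume Q ^ (a / ((d : ℝ) + 2)) := by
  have ha' : 0 ≤ a / ((d : ℝ) + 2) := by positivity
  have hAκ0 : A * unitPballVolume d ≠ 0 :=
    mul_ne_zero (ENNReal.coe_ne_zero.2 hA) unitPballVolume_ne_zero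
  have hAκt : A * unitPballVolume d ≠ ∞ :=
    ENNReal.mul_ne_top ENNReal.coe_ne_top unitPballVolume_ne_top
  have hρQ : ENNReal.ofReal ρ ^ (d + 2) ≤ (A * unitPballVolume d)⁻¹ * volume Q := by
    rw [← ENNReal.div_eq_inv_mul, ENNReal.le_div_iff_mul_le (Or.inl hAκ0) (Or.inl hAκt)]
    rwa [volume_pball X hρ, mul_left_comm] at hQ
  calc ENNReal.ofReal ρ ^ a = (ENNReal.ofReal ρ ^ (d + 2)) ^ (a / ((d : ℝ) + 2)) := by
        rw [← ENNReal.rpow_natCast, ← ENNReal.rpow_mul]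
        congr 1
        push_cast
        field_simp
    _ ≤ _ := (ENNReal.rpow_le_rpow hρQ ha').trans_eq (ENNReal.mul_rpow_of_nonneg _ _ ha')

lemma volume_inter_pball_ne_top (D : Set (SpaceTime d)) (X : SpaceTime d) {c : ℝ} (hc : 0 < c) :
    volume (D ∩ pball X c) ≠ ∞ := by
  refine measure_ne_top_of_subset inter_subset_right ?_
  rw [volume_pball X hc]
  exact ENNReal.mul_ne_top (ENNReal.pow_ne_top ENNReal.ofReal_ne_top) unitPballVolume_ne_top

lemma volume_ne_zero_of_mul_volume_pball_le {X : SpaceTime d} {Q : Set (SpaceTime d)}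
    (hA : A ≠ 0) {ρ : ℝ} (hρ : 0 < ρ) (hQ : A * volume (pball X ρ) ≤ volume Q) : volume Q ≠ 0 := by
  rw [volume_pball X hρ] at hQ
  exact ((ENNReal.mul_pos (ENNReal.coe_ne_zero.2 hA) (mul_ne_zero
    (pow_ne_zero _ (ENNReal.ofReal_pos.2 hρ).ne') unitPballVolume_ne_zero)).trans_le hQ).ne'

lemma campanatoSeminorm_le [SFinite P] (hA : IsATypeWith A D) (hDm : MeasurableSet D)
    (hD : D.Nontrivial) (hu : Measurable fun q : SpaceTime d × Ω ↦ u q.1 q.2) (hp : 0 ≤ p)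
    (hγ : 0 ≤ γ) (hC : ∀ Y ∈ D, ∀ Z ∈ D,
      ∫⁻ ω, ‖u Y ω - u Z ω‖ₑ ^ p ∂P ≤ C * ENNReal.ofReal (pdist Y Z) ^ (γ * p)) :
    campanatoSeminorm p (1 + γ * p / ((d : ℝ) + 2)) D P u ≤ campanatoConst d p γ A C := by
  have hγp : 0 ≤ γ * p := mul_nonneg hγ hp
  rw [campanatoSeminorm, campanatoConst]
  gcongr
  refine iSup₂_le fun X hX ↦ iSup₂_le fun c hc ↦ ?_
  obtain ⟨ρ, hρ, hvol, hdiam⟩ := hA.exists_radius hD hX hc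
  have hQ0 := volume_ne_zero_of_mul_volume_pball_le hA.1.ne' hρ hvol
  have hQt := volume_inter_pball_ne_top D X hc
  have hρQ := rpow_radius_le hA.1.ne' hγp hρ hvol
  set Q := D ∩ pball X c
  set a := γ * p / ((d : ℝ) + 2)
  have hpow : volume Q ^ (1 + (1 + a)) = volume Q ^ a * volume Q ^ 2 := by
    rw [← ENNReal.rpow_natCast, ← ENNReal.rpow_add _ _ hQ0 hQt]
    congr 1
    push_cast
    ring
  refine ENNReal.div_le_of_le_mul ?_
  calc _ ≤ C * ENNReal.ofReal (2 * ρ) ^ (γ * p) * volume Q ^ 2 := by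
        refine lintegral_rpow_enorm_sub_le hu (hDm.inter (measurableSet_pball X c))
          fun Y hY Z hZ ↦ (hC Y hY.1 Z hZ.1).trans ?_
        gcongr
        exact hdiam Y hY Z hZ
    _ ≤ C * (2 ^ (γ * p) * ((A * unitPballVolume d)⁻¹ ^ a * volume Q ^ a)) * volume Q ^ 2 := by
        rw [ENNReal.ofReal_mul zero_le_two, ENNReal.ofReal_ofNat,
          ENNReal.mul_rpow_of_nonneg _ _ hγp]
        gcongr
    _ = _ := by rw [hpow]; ring

end Campanato

section Existence

variable {d : ℕ} {β γ₁ γ₂ : ℝ} {T : ℝ≥0∞} {C N₀ N₁ N₂ : ℝ≥0} {K g : SpaceTime d → ℝ}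
  {Ω : Type*} [MeasurableSpace Ω] {P : Measure Ω} [IsProbabilityMeasure P] {W : ℝ≥0 → Ω → ℝ}

lemma measurableSet_timeStrip (d : ℕ) (T : ℝ≥0∞) : MeasurableSet (timeStrip d T) :=
  (measurableSet_lt measurable_const measurable_fst).inter
    (measurableSet_lt (ENNReal.measurable_ofReal.comp measurable_fst) measurable_const)

lemma continuous_toLp_wienerIntegral (hW : IsWienerProcess T W P) (hK : Measurable K)
    (hB : KernelBounds T β γ₁ γ₂ N₀ N₁ N₂ K) (hg : IsPHolderWith C β g) (hg0 : g (0, 0) = 0)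
    (hβ : 0 < β) (hβ' : β ≤ 1) (hγ₁ : 0 < γ₁) (hγ₂ : 0 < γ₂) {ξ : timeStrip d T → Ω → ℝ}
    (hξ : ∀ X : timeStrip d T, IsWienerIntegral W P X.1.1 (innerConv K g X) (ξ X)) :
    Continuous fun X ↦ ((hξ X).2.1.mono_exponent one_le_two : MemLp (ξ X) 1 P).toLp (ξ X) := by
  refine continuous_iff_continuousAt.2 fun X ↦ tendsto_iff_edist_tendsto_0.2 ?_
  set γ := min (min γ₁ γ₂) β
  have hγ : 0 < γ := lt_min (lt_min hγ₁ hγ₂) hβ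
  set M : ℝ≥0 := 1 + (1 + ‖(X : SpaceTime d)‖₊)
  have hM {Z : SpaceTime d} (hZ : ‖Z‖ ≤ 1 + ‖(X : SpaceTime d)‖) : pdist Z 0 ≤ M :=
    (pdist_zero_le_one_add_norm Z).trans (by simpa [M] using hZ)
  set N : ℝ≥0∞ := eLpNorm id 1 (gaussianReal 0 1) * holderConst β γ₁ γ₂ N₀ N₁ N₂ C M
  have hN : N ≠ ∞ :=
    ENNReal.mul_ne_top (eLpNorm_id_gaussianReal_ne_top ENNReal.one_ne_top) ENNReal.coe_ne_top
  have hnear : ∀ᶠ Y : timeStrip d T in 𝓝 X, ‖(Y : SpaceTime d)‖ < 1 + ‖(X : SpaceTime d)‖ :=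
    (continuous_subtype_val.norm.tendsto X).eventually_lt_const (lt_one_add _)
  have hlim : Tendsto (fun Y : timeStrip d T ↦ N * ENNReal.ofReal (pdist Y.1 X.1) ^ γ)
      (𝓝 X) (𝓝 0) := by
    have h := ENNReal.Tendsto.const_mul
      ((tendsto_ofReal_pdist_rpow X.1 hγ).comp (continuous_subtype_val.tendsto X)) (Or.inr hN)
    rwa [mul_zero] at h
  refine tendsto_of_tendsto_of_tendsto_of_le_of_le' tendsto_const_nhds hlim
    (Eventually.of_forall fun _ ↦ zero_le) (hnear.mono fun Y hY ↦ ?_)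
  rw [Lp.edist_toLp_toLp, mul_assoc]
  exact IsWienerIntegral.eLpNorm_sub_le hW hK hB hg hg0 hβ hβ' hγ₁.le hγ₂.le Y.2 X.2
    (hM hY.le) (hM (lt_one_add _).le) (hξ Y) (hξ X) 1

lemma exists_isStochasticConvolution (hW : IsWienerProcess T W P) (hK : Measurable K)
    (hB : KernelBounds T β γ₁ γ₂ N₀ N₁ N₂ K) (hg : IsPHolderWith C β g) (hg0 : g (0, 0) = 0)
    (hβ : 0 < β) (hβ' : β ≤ 1) (hγ₁ : 0 < γ₁) (hγ₂ : 0 < γ₂) :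
    ∃ u : SpaceTime d → Ω → ℝ, IsStochasticConvolution T K g W P u := by
  choose ξ hξ using fun X : timeStrip d T ↦
    exists_isWienerIntegral hW X.2.2.le (memLp_innerConv hK hB hg hg0 hβ hβ' hγ₂.le X.2)
  have hcont := continuous_toLp_wienerIntegral hW hK hB hg hg0 hβ hβ' hγ₁ hγ₂ hξ
  obtain ⟨F, hF, hFξ⟩ := (MeasurableEmbedding.subtype_coe
    (measurableSet_timeStrip d T)).exists_stronglyMeasurable_extend hcont.stronglyMeasurable
      fun _ ↦ inferInstance
  obtain ⟨u, hu, huF⟩ := exists_measurable_version hF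
  refine ⟨u, hu, fun X hX ↦ hB.ae_integrable_innerConv hK hβ hβ' hg hg0 hX, fun X hX ↦ ?_⟩
  have huξ : u X =ᵐ[P] ξ ⟨X, hX⟩ := by
    have hFX : F X = _ := congrFun hFξ ⟨X, hX⟩
    exact (huF X).trans (hFX ▸ MemLp.coeFn_toLp _)
  exact (hξ ⟨X, hX⟩).congr huξ.symm

end Existence

section CampanatoBound

variable {d : ℕ} {β γ₁ γ₂ p R : ℝ} {T : ℝ≥0∞} {C N₀ N₁ N₂ A : ℝ≥0} {K g : SpaceTime d → ℝ}
  {Ω : Type*} [MeasurableSpace Ω] {P : Measure Ω} [IsProbabilityMeasure P] {W : ℝ≥0 → Ω → ℝ}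
  {u : SpaceTime d → Ω → ℝ}

/-- The Hölder constant of the `p`-th moments of the increments of the stochastic convolution on
`{X : δ(X, 0) ≤ M}`: the absolute Gaussian moment of order `p` times the `p`-th power of
`holderConst`. -/
noncomputable def momentConst (p β γ₁ γ₂ : ℝ) (N₀ N₁ N₂ C M : ℝ≥0) : ℝ≥0∞ :=
  (eLpNorm id (ENNReal.ofReal p) (gaussianReal 0 1) * holderConst β γ₁ γ₂ N₀ N₁ N₂ C M) ^ p

lemma momentConst_ne_top (hp : 0 ≤ p) {M : ℝ≥0} : momentConst p β γ₁ γ₂ N₀ N₁ N₂ C M ≠ ∞ :=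
  ENNReal.rpow_ne_top_of_nonneg hp (ENNReal.mul_ne_top
    (eLpNorm_id_gaussianReal_ne_top ENNReal.ofReal_ne_top) ENNReal.coe_ne_top)

lemma IsStochasticConvolution.lintegral_rpow_enorm_sub_le
    (hu : IsStochasticConvolution T K g W P u) (hW : IsWienerProcess T W P) (hK : Measurable K)
    (hB : KernelBounds T β γ₁ γ₂ N₀ N₁ N₂ K) (hg : IsPHolderWith C β g) (hg0 : g (0, 0) = 0)
    (hp : 0 < p) (hβ : 0 < β) (hβ' : β ≤ 1) (hγ₁ : 0 ≤ γ₁) (hγ₂ : 0 ≤ γ₂) {M : ℝ≥0}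
    {X Y : SpaceTime d} (hX : X ∈ timeStrip d T) (hY : Y ∈ timeStrip d T)
    (hXM : pdist X 0 ≤ M) (hYM : pdist Y 0 ≤ M) :
    ∫⁻ ω, ‖u X ω - u Y ω‖ₑ ^ p ∂P ≤ momentConst p β γ₁ γ₂ N₀ N₁ N₂ C M *
      ENNReal.ofReal (pdist X Y) ^ (min (min γ₁ γ₂) β * p) := by
  have h := IsWienerIntegral.eLpNorm_sub_le hW hK hB hg hg0 hβ hβ' hγ₁ hγ₂ hX hY hXM hYM
    (hu.version X hX) (hu.version Y hY) (ENNReal.ofReal p)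
  rwa [eLpNorm_eq_lintegral_rpow_enorm_toReal (ENNReal.ofReal_pos.2 hp).ne' ENNReal.ofReal_ne_top,
    ENNReal.toReal_ofReal hp.le, one_div, ENNReal.rpow_inv_le_iff hp, ← mul_assoc,
    ENNReal.mul_rpow_of_nonneg _ _ hp.le, ← ENNReal.rpow_mul] at h

lemma IsStochasticConvolution.campanatoSeminorm_le (hu : IsStochasticConvolution T K g W P u)
    (hW : IsWienerProcess T W P) (hK : Measurable K) (hB : KernelBounds T β γ₁ γ₂ N₀ N₁ N₂ K)
    (hg : IsPHolderWith C β g) (hg0 : g (0, 0) = 0) (hp : 0 < p) (hβ : 0 < β) (hβ' : β ≤ 1)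
    (hγ₁ : 0 ≤ γ₁) (hγ₂ : 0 ≤ γ₂) {D : Set (SpaceTime d)} (hDm : MeasurableSet D)
    (hD : D.Nontrivial) (hDR : D ⊆ Metric.closedBall 0 R) (hDT : D ⊆ timeStrip d T)
    (hA : IsATypeWith A D) :
    campanatoSeminorm p (1 + min (min γ₁ γ₂) β * p / ((d : ℝ) + 2)) D P u ≤
      campanatoConst d p (min (min γ₁ γ₂) β) A
        (momentConst p β γ₁ γ₂ N₀ N₁ N₂ C (1 + R.toNNReal)) := by
  have hM {X : SpaceTime d} (hX : X ∈ D) : pdist X 0 ≤ (1 + R.toNNReal : ℝ≥0) := by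
    rw [NNReal.coe_add, NNReal.coe_one]
    exact (pdist_zero_le_one_add_norm X).trans
      (by gcongr; exact (mem_closedBall_zero_iff.1 (hDR hX)).trans (Real.le_coe_toNNReal R))
  exact StochConv.campanatoSeminorm_le hA hDm hD hu.measurable hp.le
    (le_min (le_min hγ₁ hγ₂) hβ.le) fun Y hY Z hZ ↦ hu.lintegral_rpow_enorm_sub_le hW hK hB hg hg0
      hp hβ hβ' hγ₁ hγ₂ (hDT hY) (hDT hZ) (hM hY) (hM hZ)

end CampanatoBound

end StochConv

theorem theorem2p1_general (d : ℕ) {p : ℝ} (hp : 0 < p) {β γ₁ γ₂ : ℝ} (hβ : 0 < β) (hβ' : β ≤ 1)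
    (hγ₁ : 0 < γ₁) (hγ₂ : 0 < γ₂) (N₀ N₁ N₂ Cg A : ℝ≥0) (R : ℝ) :
    ∃ N : ℝ≥0, ∀ (T : ℝ≥0∞) (K g : SpaceTime d → ℝ),
      Measurable K → KernelBounds T β γ₁ γ₂ N₀ N₁ N₂ K →
      IsPHolderWith Cg β g → g (0, 0) = 0 →
      ∀ (Ω : Type*) [MeasurableSpace Ω] (P : Measure Ω) [IsProbabilityMeasure P]
        (W : ℝ≥0 → Ω → ℝ), IsWienerProcess T W P →
        (∃ u : SpaceTime d → Ω → ℝ, IsStochasticConvolution T K g W P u) ∧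
        ∀ u : SpaceTime d → Ω → ℝ, IsStochasticConvolution T K g W P u →
          ∀ D : Set (SpaceTime d), MeasurableSet D → D.Nontrivial →
            D ⊆ Metric.closedBall 0 R → D ⊆ timeStrip d T → IsATypeWith A D →
            campanatoSeminorm p (1 + min (min γ₁ γ₂) β * p / ((d : ℝ) + 2)) D P u ≤ N := by
  refine ⟨(campanatoConst d p (min (min γ₁ γ₂) β) A
    (momentConst p β γ₁ γ₂ N₀ N₁ N₂ Cg (1 + R.toNNReal))).toNNReal,
    fun T K g hK hB hg hg0 Ω _ P _ W hW ↦
      ⟨exists_isStochasticConvolution hW hK hB hg hg0 hβ hβ' hγ₁ hγ₂,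
        fun u hu D hDm hD hDR hDT hA ↦ ?_⟩⟩
  rw [ENNReal.coe_toNNReal (campanatoConst_ne_top hp.le (le_min (le_min hγ₁.le hγ₂.le) hβ.le)
    hA.1.ne' (momentConst_ne_top hp.le))]
  exact hu.campanatoSeminorm_le hW hK hB hg hg0 hp hβ hβ' hγ₁.le hγ₂.le hDm hD hDR hDT hA

theorem theorem2p1 (d : ℕ) (T : ℝ≥0∞) (hT : 0 < T) (p : ℝ) (hp : 1 ≤ p)
    (β γ₁ γ₂ : ℝ) (hβ₀ : 0 < β) (hβ₁ : β < 1) (hγ₁ : 0 < γ₁) (hγ₂ : 0 < γ₂)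
    (N₀ N₁ N₂ Cg A : ℝ≥0) (R : ℝ) :
    ∃ N : ℝ≥0, ∀ (K g : SpaceTime d → ℝ),
      Measurable K → KernelBounds T β γ₁ γ₂ N₀ N₁ N₂ K →
      IsPHolderWith Cg β g → g (0, 0) = 0 →
      ∀ (Ω : Type*) [MeasurableSpace Ω] (P : Measure Ω) [IsProbabilityMeasure P]
        (W : ℝ≥0 → Ω → ℝ), IsWienerProcess T W P →
        (∃ u : SpaceTime d → Ω → ℝ, IsStochasticConvolution T K g W P u) ∧
        ∀ u : SpaceTime d → Ω → ℝ, IsStochasticConvolution T K g W P u →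
          ∀ D : Set (SpaceTime d), IsOpen D → IsConnected D →
            D ⊆ Metric.closedBall 0 R → closure D ⊆ timeStrip d T → IsATypeWith A D →
            campanatoSeminorm p (1 + min (min γ₁ γ₂) β * p / ((d : ℝ) + 2)) D P u ≤ N := by
  obtain ⟨N, hN⟩ := theorem2p1_general d (one_pos.trans_le hp) hβ₀ hβ₁.le hγ₁ hγ₂ N₀ N₁ N₂ Cg A R
  exact ⟨N, fun K g hK hB hg hg0 Ω _ P _ W hW ↦ (hN T K g hK hB hg hg0 Ω P W hW).imp_right
    fun h u hu D hDo hDc hDR hDT ↦ h u hu D hDo.measurableSet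
      (nontrivial_of_isOpen hDo hDc.nonempty) hDR (subset_closure.trans hDT)⟩
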